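/- Let $d\ge 2$, $N\ge 1$, $A,B\in\mathbb C^{N,N}$ and $S\in\mathbb R^{d,d}$ be such that $A$ and $B$ are simultaneously diagonalizable (there is an invertible $Y\in\mathbb C^{N,N}$ with $Y^{-1}AY$ and $Y^{-1}BY$ diagonal), every eigenvalue of $A$ has positive real part, and $S^{T}=-S$. Write $\rho$ for the spectral radius, $s$ for the spectral abscissa, $|\cdot|$ for the Euclidean and spectral norms, and put $$a_{\min}=\rho(A^{-1})^{-1},\quad a_{\max}=\rho(A),\quad a_0=-s(-A),\quad b_0=-s(-B),\quad \omega_b=-b_0,\quad a_1=\frac{a_{\max}^2}{a_{\min}a_0},\quad \kappa=|Y||Y^{-1}|.$$ For $t>0$ let $$[T(t)v](x)=\int_{\mathbb R^d}H(x,\xi,t)v(\xi)\,d\xi,\qquad H(x,\xi,t)=(4\pi tA)^{-d/2}\exp\!\big(-Bt-(4tA)^{-1}|e^{tS}x-\xi|^2\big),$$ with the principal matrix power, and $T(0)v=v$. Let $C_{ub}$ be the space of bounded uniformly continuous functions $\mathbb R^d\to\mathbb C^N$, let $C_{ub}^1$ be the space of $C^1$ functions $v$ with $v,D_1v,\dots,D_dv\in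 C_{ub}$, and let $$C_{rub}=\{v\in C_{ub}:\ \lim_{t\to0}\sup_x|v(e^{-tS}x)-v(x)|=0\},$$ with the supremum norm. Let $(A_b,\mathcal D(A_b))$ be the infinitesimal generator of $(T(t))_{t\ge 0}$ on $C_{rub}$: $v\in\mathcal D(A_b)$ and $A_bv=w$ mean that $v,w\in C_{rub}$ and $(T(t)v-v)/t\to w$ uniformly on $\mathbb R^d$ as $t\downarrow0$. Let $0<\vartheta<1$ and $\lambda\in\mathbb C$ with $\operatorname{Re}\lambda>\omega_b$. Let $\theta\in C(\mathbb R^d,\mathbb R)$ be a radial weight function of exponential growth rate $\eta\ge0$, that is, $\theta(x)>0$, $\theta(x)$ depends only on $|x|$, and for some $C_\theta>0$ $$\theta(x+y)\le C_\theta\,\theta(x)\,e^{\eta|y|}\qquad\text{for all }x,y\in\mathbb R^d.$$ Suppose that $$\eta^2\le\vartheta\,\frac{a_0(\operatorname{Re}\lambda-\omega_b)}{a_{\max}^2}$$ and that there is $C>0$ with $\theta(x)\ge C$ for all $x$. Let $C_{b,\theta}$ be the space of continuous $v:\mathbb R^d\to\mathbb C^N$ with $\|v\|_{C_{b,\theta}}=\sup_x|\theta(x)v(x)|<\infty$,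 and $C_{b,\theta}^1$ the space of $C^1$ functions $v$ with $v,D_1v,\dots,D_dv\in C_{b,\theta}$. Let $g\in C_{rub}$. Then the resolvent equation $(\lambda I-A_b)v=g$ has a unique solution $v_\star\in\mathcal D(A_b)$, and $v_\star\in C_{rub}\cap C^1_{ub}$. If in addition $g\in C_{b,\theta}$, then $v_\star\in C_{rub}\cap C_{ub}^1\cap C^1_{b,\theta}$ and $$\|v_\star\|_{C_{b,\theta}}\le\frac{C_7}{\operatorname{Re}\lambda-\omega_b}\|g\|_{C_{b,\theta}},\qquad \|D_iv_\star\|_{C_{b,\theta}}\le\frac{C_8}{(\operatorname{Re}\lambda-\omega_b)^{1/2}}\|g\|_{C_{b,\theta}}\quad(i=1,\dots,d),$$ and for every $x\in\mathbb R^d$ $$|v_\star(x)|\le\frac{C_7}{\operatorname{Re}\lambda-\omega_b}\,\frac1{\theta(x)}\,\|g\|_{C_{b,\theta}},\qquad |D_iv_\star(x)|\le\frac{C_8}{(\operatorname{Re}\lambda-\omega_b)^{1/2}}\,\frac1{\theta(x)}\,\|g\|_{C_{b,\theta}}\quad(i=1,\dots,d).$$ The $\lambda$-independent constants are, with $q=\frac{\vartheta}{1-\vartheta}$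 and ${}_2F_1$ the Gauss hypergeometric function (analytically continued to $]-\infty,1[$), $$C_7=\frac{C_\theta\,\kappa\,a_1^{d/2}}{1-\vartheta}\Big({}_2F_1\big(-\tfrac{d-1}2,1;\tfrac12;-q\big)+\pi^{1/2}\tfrac{\Gamma(\frac{d+1}2)}{\Gamma(\frac d2)}\,q^{1/2}\,{}_2F_1\big(-\tfrac{d-2}2,\tfrac32;\tfrac32;-q\big)\Big),$$ $$C_8=\frac{C_\theta\,\kappa\,a_1^{(d+1)/2}\,\Gamma(\frac12)}{a_{\min}^{1/2}(1-\vartheta)^{1/2}}\Big(\tfrac{\Gamma(\frac{d+1}2)}{\Gamma(\frac d2)}\,{}_2F_1\big(-\tfrac d2,\tfrac12;\tfrac12;-q\big)+2\tfrac{\Gamma(\frac{d+2}2)}{\Gamma(\frac12)\Gamma(\frac d2)}\,q^{1/2}\,{}_2F_1\big(-\tfrac{d-1}2,1;\tfrac32;-q\big)\Big).$$ -/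

import Mathlib

open scoped NNReal Topology
open Filter MeasureTheory

noncomputable section

namespace OU

/-- The Euclidean space `ℝ^d`. -/
abbrev Rd (d : ℕ) := EuclideanSpace ℝ (Fin d)

/-- The Hermitian space `ℂ^N`. -/
abbrev CN (N : ℕ) := EuclideanSpace ℂ (Fin N)

/-! ### Matrix quantities -/

/-- `Y` is invertible and diagonalizes both `A` and `B`. -/
def SimDiagonalizable {N : ℕ} (A B Y : Matrix (Fin N) (Fin N) ℂ) : Prop :=
  IsUnit Y ∧ (Y⁻¹ * A * Y).IsDiag ∧ (Y⁻¹ * B * Y).IsDiag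

/-- The spectral radius `ρ(C)` as a real number. -/
def rho {N : ℕ} (C : Matrix (Fin N) (Fin N) ℂ) : ℝ := (spectralRadius ℂ C).toReal

/-- The spectral abscissa `s(C) = max_{z ∈ σ(C)} Re z`. -/
def abscissa {N : ℕ} (C : Matrix (Fin N) (Fin N) ℂ) : ℝ := sSup (Complex.re '' spectrum ℂ C)

/-- `a_min = ρ(A⁻¹)⁻¹`. -/
def aMin {N : ℕ} (A : Matrix (Fin N) (Fin N) ℂ) : ℝ := (rho A⁻¹)⁻¹

/-- `a_max = ρ(A)`. -/
def aMax {N : ℕ} (A : Matrix (Fin N) (Fin N) ℂ) : ℝ := rho A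

/-- `a_0 = -s(-A)`. -/
def aZero {N : ℕ} (A : Matrix (Fin N) (Fin N) ℂ) : ℝ := -abscissa (-A)

/-- `b_0 = -s(-B)`. -/
def bZero {N : ℕ} (B : Matrix (Fin N) (Fin N) ℂ) : ℝ := -abscissa (-B)

/-- `ω_b = -b_0`. -/
def omegaB {N : ℕ} (B : Matrix (Fin N) (Fin N) ℂ) : ℝ := -bZero B

/-- `a_1 = a_max² / (a_min a_0)`. -/
def aOne {N : ℕ} (A : Matrix (Fin N) (Fin N) ℂ) : ℝ := aMax A ^ 2 / (aMin A * aZero A)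

/-- The spectral norm of a matrix. -/
def specNorm {N : ℕ} (C : Matrix (Fin N) (Fin N) ℂ) : ℝ :=
  ‖Matrix.toEuclideanCLM (n := Fin N) (𝕜 := ℂ) C‖

/-- The condition number `|Y| |Y⁻¹|` in the spectral norm. -/
def cond {N : ℕ} (Y : Matrix (Fin N) (Fin N) ℂ) : ℝ := specNorm Y * specNorm Y⁻¹

open scoped Classical in
/-- The principal power `M ^ s` of a diagonalizable matrix: the value at `M` of any polynomial
which agrees with `z ↦ z ^ s` (principal branch) on the eigenvalues of `M`.  Thus
`(Y * diag(μ) * Y⁻¹) ^ s = Y * diag(μ ^ s) * Y⁻¹`. -/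
def matCPow {N : ℕ} (M : Matrix (Fin N) (Fin N) ℂ) (s : ℂ) : Matrix (Fin N) (Fin N) ℂ :=
  Polynomial.aeval M
    (Lagrange.interpolate M.charpoly.roots.toFinset (fun z : ℂ => z) (fun z : ℂ => z ^ s))

/-! ### The Ornstein-Uhlenbeck semigroup -/

/-- `rot S t x = e^{tS} x`. -/
def rot {d : ℕ} (S : Matrix (Fin d) (Fin d) ℝ) (t : ℝ) (x : Rd d) : Rd d :=
  WithLp.toLp 2 ((NormedSpace.exp (t • S)).mulVec x.ofLp)

/-- The heat kernel matrix
`H(x,ξ,t) = (4πtA)^{-d/2} exp(-Bt - (4tA)⁻¹ |e^{tS}x - ξ|²)`. -/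
def heatKernel {d N : ℕ} (A B : Matrix (Fin N) (Fin N) ℂ) (S : Matrix (Fin d) (Fin d) ℝ)
    (x ξ : Rd d) (t : ℝ) : Matrix (Fin N) (Fin N) ℂ :=
  matCPow ((4 * Real.pi * t : ℂ) • A) (-(d : ℂ) / 2) *
    NormedSpace.exp (-((t : ℂ) • B) -
      ((‖rot S t x - ξ‖ ^ 2 : ℝ) : ℂ) • ((4 * t : ℂ) • A)⁻¹)

/-- The operators `T(t)`: `[T(t)v](x) = ∫ H(x,ξ,t) v(ξ) dξ` for `t > 0` and `T(0)v = v`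
(only `t ≥ 0` is relevant). -/
def semigroup {d N : ℕ} (A B : Matrix (Fin N) (Fin N) ℂ) (S : Matrix (Fin d) (Fin d) ℝ)
    (t : ℝ) (v : Rd d → CN N) (x : Rd d) : CN N :=
  if 0 < t then ∫ ξ : Rd d, WithLp.toLp 2 ((heatKernel A B S x ξ t).mulVec (v ξ).ofLp)
  else v x

/-! ### Function spaces -/

/-- `v ∈ C_b(ℝ^d, ℂ^N)`. -/
def MemCb {d N : ℕ} (v : Rd d → CN N) : Prop :=
  Continuous v ∧ ∃ M : ℝ, ∀ x, ‖v x‖ ≤ M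

/-- `v ∈ C_ub(ℝ^d, ℂ^N)`. -/
def MemCub {d N : ℕ} (v : Rd d → CN N) : Prop :=
  MemCb v ∧ UniformContinuous v

/-- `v ∈ C_rub(ℝ^d, ℂ^N)`: moreover `sup_x |v(e^{-tS}x) - v(x)| → 0` as `t → 0`. -/
def MemCrub {d N : ℕ} (S : Matrix (Fin d) (Fin d) ℝ) (v : Rd d → CN N) : Prop :=
  MemCub v ∧ TendstoUniformly (fun (t : ℝ) (x : Rd d) => v (rot S (-t) x)) v (𝓝 0)

/-- The partial derivative `D_i v`. -/
def partialD {d N : ℕ} (i : Fin d) (v : Rd d → CN N) (x : Rd d) : CN N :=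
  fderiv ℝ v x (EuclideanSpace.single i 1)

/-- `v ∈ C^1_ub(ℝ^d, ℂ^N)`. -/
def MemC1ub {d N : ℕ} (v : Rd d → CN N) : Prop :=
  ContDiff ℝ 1 v ∧ MemCub v ∧ ∀ i, MemCub (partialD i v)

/-- `v ∈ C_{b,θ}(ℝ^d, ℂ^N)`. -/
def MemCbW {d N : ℕ} (θ : Rd d → ℝ) (v : Rd d → CN N) : Prop :=
  Continuous v ∧ BddAbove (Set.range fun x => ‖θ x • v x‖)

/-- `v ∈ C^1_{b,θ}(ℝ^d, ℂ^N)`. -/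
def MemC1bW {d N : ℕ} (θ : Rd d → ℝ) (v : Rd d → CN N) : Prop :=
  ContDiff ℝ 1 v ∧ MemCbW θ v ∧ ∀ i, MemCbW θ (partialD i v)

/-- The norm `sup_x |θ(x) v(x)|` of `C_{b,θ}(ℝ^d, ℂ^N)`. -/
def normCbW {d N : ℕ} (θ : Rd d → ℝ) (v : Rd d → CN N) : ℝ :=
  ⨆ x, ‖θ x • v x‖

/-- `θ` is a radial weight function of exponential growth rate `η`, with constant `Cθ` in the
growth estimate. -/
structure IsRadialWeight {d : ℕ} (θ : Rd d → ℝ) (η Cθ : ℝ) : Prop where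
  continuous : Continuous θ
  rate_nonneg : 0 ≤ η
  pos : ∀ x, 0 < θ x
  const_pos : 0 < Cθ
  growth : ∀ x y, θ (x + y) ≤ Cθ * θ x * Real.exp (η * ‖y‖)
  radial : ∃ φ : ℝ≥0 → ℝ, ∀ x, θ x = φ ‖x‖₊

/-! ### The generator and the resolvent equation -/

/-- The graph of the infinitesimal generator `A_b` of `T(t)` in `C_rub`: `v ∈ D(A_b)` and
`A_b v = w`, i.e. `(T(t)v - v)/t → w` in the sup norm as `t ↓ 0`, with `v, w ∈ C_rub`. -/
def GeneratorGraph {d N : ℕ} (A B : Matrix (Fin N) (Fin N) ℂ) (S : Matrix (Fin d) (Fin d) ℝ)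
    (v w : Rd d → CN N) : Prop :=
  MemCrub S v ∧ MemCrub S w ∧
    TendstoUniformly (fun (t : ℝ) (x : Rd d) => t⁻¹ • (semigroup A B S t v x - v x)) w (𝓝[>] 0)

/-- `v ∈ D(A_b)` and `(λ I - A_b) v = g`. -/
def SolvesResolvent {d N : ℕ} (A B : Matrix (Fin N) (Fin N) ℂ) (S : Matrix (Fin d) (Fin d) ℝ)
    (lam : ℂ) (g v : Rd d → CN N) : Prop :=
  ∃ w, GeneratorGraph A B S v w ∧ ∀ x, lam • v x - w x = g x

/-! ### The constants -/

/-- The Gauss hypergeometric function `₂F₁(a, b; c; z)` for real `z < 1`: the hypergeometric series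
if `|z| < 1`, and its analytic continuation
`(1 - z)^{-b} ₂F₁(c - a, b; c; z / (z - 1))` (Pfaff's formula) if `z ≤ -1`. -/
def hyp2F1 (a b c z : ℝ) : ℝ :=
  if |z| < 1 then ordinaryHypergeometric a b c z
  else (1 - z) ^ (-b) * ordinaryHypergeometric (c - a) b c (z / (z - 1))

/-- The constant `C_7`. -/
def constC7 (d : ℕ) {N : ℕ} (A Y : Matrix (Fin N) (Fin N) ℂ) (ϑ Cθ : ℝ) : ℝ :=
  Cθ * cond Y * aOne A ^ ((d : ℝ) / 2) * (1 / (1 - ϑ)) *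
    (hyp2F1 (-((d : ℝ) - 1) / 2) 1 (1 / 2) (-(ϑ / (1 - ϑ))) +
      Real.pi ^ ((1 : ℝ) / 2) * (Real.Gamma (((d : ℝ) + 1) / 2) / Real.Gamma ((d : ℝ) / 2)) *
        (ϑ / (1 - ϑ)) ^ ((1 : ℝ) / 2) *
        hyp2F1 (-((d : ℝ) - 2) / 2) (3 / 2) (3 / 2) (-(ϑ / (1 - ϑ))))

/-- The constant `C_8`. -/
def constC8 (d : ℕ) {N : ℕ} (A Y : Matrix (Fin N) (Fin N) ℂ) (ϑ Cθ : ℝ) : ℝ :=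
  Cθ * cond Y * aOne A ^ (((d : ℝ) + 1) / 2) *
    (Real.Gamma (1 / 2) / aMin A ^ ((1 : ℝ) / 2)) * (1 / (1 - ϑ)) ^ ((1 : ℝ) / 2) *
    (Real.Gamma (((d : ℝ) + 1) / 2) / Real.Gamma ((d : ℝ) / 2) *
        hyp2F1 (-(d : ℝ) / 2) (1 / 2) (1 / 2) (-(ϑ / (1 - ϑ))) +
      2 * (Real.Gamma (((d : ℝ) + 2) / 2) / (Real.Gamma (1 / 2) * Real.Gamma ((d : ℝ) / 2))) *
        (ϑ / (1 - ϑ)) ^ ((1 : ℝ) / 2) *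
        hyp2F1 (-((d : ℝ) - 1) / 2) 1 (3 / 2) (-(ϑ / (1 - ϑ))))

end OU

end

/-!
Diagonalizing `A` and `B` by `Y` turns `T(t)` into a family of scalar semigroups: each is the
convolution with a complex Gaussian followed by the rotation `e^{tS}`.  These are strongly
continuous on `C_rub`, so the resolvent is the Laplace transform of `T(t)`.  The gradient of `T(t)`
has an integrable singularity `t^{-1/2}` at `t = 0`, hence the Laplace transform may be
differentiated under the integral.

For the weighted bounds, `e^{tS}` preserves the radial weight, and a displacement by `√t y` costs at
most the factor `C_θ e^{η √t |y|}`.  Expanding this exponential reduces both bounds to a power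
series in `ϑ` whose coefficients are moments of a real Gaussian times Gamma integrals in `t`.  Its
even and odd parts are hypergeometric series in `ϑ`, and Pfaff's transformation turns these into the
functions of `-ϑ / (1 - ϑ)` in `C_7` and `C_8`.
-/

noncomputable section

namespace OU

/-! ### The Laplace transform of a strongly continuous semigroup -/

section Semigroup

variable {X : Type*} [NormedAddCommGroup X] [NormedSpace ℂ X] {T : ℝ → X →L[ℂ] X} {M ω : ℝ}

/-- `(T(t))_{t ≥ 0}` is a strongly continuous semigroup with growth bound `M e^{ωt}`.  The operators
are indexed by `ℝ`, and nothing is required of them at negative times. -/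
structure IsC0Semigroup (T : ℝ → X →L[ℂ] X) (M ω : ℝ) : Prop where
  zero : T 0 = 1
  add : ∀ {s t : ℝ}, 0 ≤ s → 0 ≤ t → T (s + t) = T s * T t
  norm_le : ∀ {t : ℝ}, 0 ≤ t → ‖T t‖ ≤ M * Real.exp (ω * t)
  continuousOn : ∀ f, ContinuousOn (fun t => T t f) (Set.Ici 0)

/-- The integrand `e^{-λt} T(t) g` of the Laplace transform of an orbit. -/
def laplaceOrbit (T : ℝ → X →L[ℂ] X) (lam : ℂ) (g : X) (t : ℝ) : X :=
  Complex.exp (-(lam * t)) • T t g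

theorem laplaceOrbit_zero (hT : IsC0Semigroup T M ω) (lam : ℂ) (g : X) :
    laplaceOrbit T lam g 0 = g := by
  simp [laplaceOrbit, hT.zero]

theorem continuousOn_laplaceOrbit (hT : IsC0Semigroup T M ω) (lam : ℂ) (g : X) :
    ContinuousOn (laplaceOrbit T lam g) (Set.Ici 0) :=
  (by fun_prop : Continuous fun t : ℝ => Complex.exp (-(lam * t))).continuousOn.smul
    (hT.continuousOn g)

theorem intervalIntegrable_laplaceOrbit (hT : IsC0Semigroup T M ω) (lam : ℂ) (g : X) {h : ℝ}
    (hh : 0 ≤ h) : IntervalIntegrable (laplaceOrbit T lam g) volume 0 h :=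
  ((continuousOn_laplaceOrbit hT lam g).mono
    (by rw [Set.uIcc_of_le hh]; exact Set.Icc_subset_Ici_self)).intervalIntegrable

theorem norm_laplaceOrbit_le (hT : IsC0Semigroup T M ω) (lam : ℂ) (g : X) {t : ℝ} (ht : 0 ≤ t) :
    ‖laplaceOrbit T lam g t‖ ≤ M * ‖g‖ * Real.exp (-(lam.re - ω) * t) :=
  calc ‖laplaceOrbit T lam g t‖
      = Real.exp (-(lam.re * t)) * ‖T t g‖ := by simp [laplaceOrbit, norm_smul, Complex.norm_exp]
    _ ≤ Real.exp (-(lam.re * t)) * (M * Real.exp (ω * t) * ‖g‖) := by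
        gcongr
        exact (T t).le_of_opNorm_le (hT.norm_le ht) g
    _ = M * ‖g‖ * Real.exp (-(lam.re - ω) * t) := by
        rw [show -(lam.re - ω) * t = -(lam.re * t) + ω * t by ring, Real.exp_add]
        ring

theorem integrableOn_laplaceOrbit (hT : IsC0Semigroup T M ω) {lam : ℂ} (hlam : ω < lam.re)
    (g : X) : IntegrableOn (laplaceOrbit T lam g) (Set.Ioi 0) :=
  Integrable.mono' ((integrableOn_exp_mul_Ioi (by linarith : -(lam.re - ω) < 0) 0).const_mul _)
    (((continuousOn_laplaceOrbit hT lam g).mono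
      Set.Ioi_subset_Ici_self).aestronglyMeasurable measurableSet_Ioi)
    ((ae_restrict_mem measurableSet_Ioi).mono fun _ ht =>
      norm_laplaceOrbit_le hT lam g (le_of_lt ht))

theorem tendsto_laplaceOrbit_atTop (hT : IsC0Semigroup T M ω) {lam : ℂ} (hlam : ω < lam.re)
    (g : X) : Tendsto (laplaceOrbit T lam g) atTop (𝓝 0) := by
  have hexp : Tendsto (fun t : ℝ => -(lam.re - ω) * t) atTop atBot :=
    tendsto_id.const_mul_atTop_of_neg (by linarith)
  refine squeeze_zero_norm' ((eventually_ge_atTop 0).mono fun t ht =>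
    norm_laplaceOrbit_le hT lam g ht) ?_
  simpa using (Real.tendsto_exp_atBot.comp hexp).const_mul (M * ‖g‖)

theorem hasDerivAt_cexp_ofReal_mul (z : ℂ) (t : ℝ) :
    HasDerivAt (fun h : ℝ => Complex.exp (z * h)) (Complex.exp (z * t) * z) t := by
  have hlin : HasDerivAt (fun h : ℝ => z * (h : ℂ)) z t := by
    simpa using (Complex.ofRealCLM.hasDerivAt (x := t)).const_mul z
  exact hlin.cexp

variable [NormedSpace ℝ X]

/-- `w` is the value at `v` of the infinitesimal generator of `(T(t))_{t ≥ 0}`; the existence of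
such a `w` expresses that `v` lies in the domain. -/
def IsGeneratorValue (T : ℝ → X →L[ℂ] X) (v w : X) : Prop :=
  Tendsto (fun h : ℝ => h⁻¹ • (T h v - v)) (𝓝[>] 0) (𝓝 w)

/-- The Laplace transform `∫₀^∞ e^{-λt} T(t) g dt` of an orbit. -/
def laplace (T : ℝ → X →L[ℂ] X) (lam : ℂ) (g : X) : X :=
  ∫ t in Set.Ioi (0 : ℝ), laplaceOrbit T lam g t

theorem laplace_sub_intervalIntegral (hT : IsC0Semigroup T M ω) {lam : ℂ} (hlam : ω < lam.re)
    (g : X) {h : ℝ} (hh : 0 ≤ h) :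
    laplace T lam g - ∫ t in (0 : ℝ)..h, laplaceOrbit T lam g t =
      ∫ t in Set.Ioi (0 : ℝ), laplaceOrbit T lam g (t + h) := by
  have hint := integrableOn_laplaceOrbit hT hlam g
  have htail : laplace T lam g - ∫ t in (0 : ℝ)..h, laplaceOrbit T lam g t =
      ∫ t in Set.Ioi h, laplaceOrbit T lam g t := by
    rw [laplace, sub_eq_iff_eq_add', intervalIntegral.integral_interval_add_Ioi hint
      (hint.mono_set (Set.Ioi_subset_Ioi hh))]
  rw [htail, ← (measurePreserving_add_right volume h).setIntegral_preimage_emb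
    (measurableEmbedding_addRight h), Set.preimage_add_const_Ioi, sub_self]

variable [IsScalarTower ℝ ℂ X]

theorem IsGeneratorValue.hasDerivWithinAt_orbit (hT : IsC0Semigroup T M ω) {u w : X}
    (hu : IsGeneratorValue T u w) {t : ℝ} (ht : 0 ≤ t) :
    HasDerivWithinAt (fun s => T s u) (T t w) (Set.Ioi t) t := by
  rw [hasDerivWithinAt_iff_tendsto_slope' (by simp)]
  have hsub : Tendsto (fun s : ℝ => s - t) (𝓝[>] t) (𝓝[>] 0) := by
    rw [Tendsto, map_subRight_nhdsGT, sub_self]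
  refine (((T t).continuous.tendsto _).comp (hu.comp hsub)).congr' ?_
  filter_upwards [self_mem_nhdsWithin] with s (hs : t < s)
  have hadd := DFunLike.congr_fun (hT.add ht (sub_nonneg.2 hs.le)) u
  rw [add_sub_cancel, mul_apply_eq_comp] at hadd
  simp only [Function.comp_apply, slope_def_module, hadd, ← map_sub]
  exact ((T t).restrictScalars ℝ).map_smul _ _

theorem IsGeneratorValue.hasDerivWithinAt_laplaceOrbit (hT : IsC0Semigroup T M ω) {lam : ℂ}
    {g u : X} (hu : IsGeneratorValue T u (lam • u - g)) {t : ℝ} (ht : 0 ≤ t) :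
    HasDerivWithinAt (laplaceOrbit T lam u) (-laplaceOrbit T lam g t) (Set.Ioi t) t := by
  have hexp := hasDerivAt_cexp_ofReal_mul (-lam) t
  simp only [neg_mul] at hexp
  refine (hexp.hasDerivWithinAt.smul (hu.hasDerivWithinAt_orbit hT ht)).congr_deriv ?_
  simp only [laplaceOrbit, map_sub, map_smul]
  module

variable [CompleteSpace X]

theorem apply_laplace (hT : IsC0Semigroup T M ω) {lam : ℂ} (hlam : ω < lam.re) (g : X) {h : ℝ}
    (hh : 0 ≤ h) :
    T h (laplace T lam g) = Complex.exp (lam * h) •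
      (laplace T lam g - ∫ t in (0 : ℝ)..h, laplaceOrbit T lam g t) := by
  rw [laplace_sub_intervalIntegral hT hlam g hh, laplace,
    ← ContinuousLinearMap.integral_comp_comm _ (integrableOn_laplaceOrbit hT hlam g),
    ← integral_smul]
  refine setIntegral_congr_fun measurableSet_Ioi fun t (ht : 0 < t) => ?_
  simp only [laplaceOrbit, map_smul, smul_smul, ← Complex.exp_add]
  rw [add_comm t h, hT.add hh ht.le, mul_apply_eq_comp]
  congr 2
  push_cast
  ring

theorem isGeneratorValue_laplace (hT : IsC0Semigroup T M ω) {lam : ℂ} (hlam : ω < lam.re) (g : X) :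
    IsGeneratorValue T (laplace T lam g) (lam • laplace T lam g - g) := by
  set v := laplace T lam g
  have hcont := continuousOn_laplaceOrbit hT lam g
  have hprimitive : HasDerivWithinAt (fun h : ℝ => ∫ t in (0 : ℝ)..h, laplaceOrbit T lam g t) g
      (Set.Ioi 0) 0 := by
    have := intervalIntegral.integral_hasDerivWithinAt_right
      (intervalIntegrable_laplaceOrbit hT lam g le_rfl) (s := Set.Ici 0) (t := Set.Ioi 0)
      ((hcont.mono Set.Ioi_subset_Ici_self).stronglyMeasurableAtFilter_nhdsWithin
        measurableSet_Ioi 0)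
      ((hcont 0 Set.self_mem_Ici).mono Set.Ioi_subset_Ici_self)
    rw [laplaceOrbit_zero hT] at this
    exact this.mono Set.Ioi_subset_Ici_self
  have hshift : HasDerivWithinAt
      (fun h : ℝ => Complex.exp (lam * h) • (v - ∫ t in (0 : ℝ)..h, laplaceOrbit T lam g t))
      (lam • v - g) (Set.Ioi 0) 0 := by
    convert! (hasDerivAt_cexp_ofReal_mul lam 0).hasDerivWithinAt.smul (hprimitive.const_sub v)
      using 1
    simp [neg_add_eq_sub]
  rw [hasDerivWithinAt_iff_tendsto_slope' (by simp)] at hshift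
  refine hshift.congr' ?_
  filter_upwards [self_mem_nhdsWithin] with h hh
  rw [slope_def_module, apply_laplace hT hlam g (le_of_lt hh)]
  simp [v]

theorem IsGeneratorValue.eq_laplace (hT : IsC0Semigroup T M ω) {lam : ℂ} (hlam : ω < lam.re)
    {g u : X} (hu : IsGeneratorValue T u (lam • u - g)) : u = laplace T lam g := by
  have hFTC : ∀ b : ℝ, 0 ≤ b → ∫ t in (0 : ℝ)..b, laplaceOrbit T lam g t =
      u - laplaceOrbit T lam u b := by
    intro b hb
    have := intervalIntegral.integral_eq_sub_of_hasDeriv_right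
      ((continuousOn_laplaceOrbit hT lam u).mono
        (by rw [Set.uIcc_of_le hb]; exact Set.Icc_subset_Ici_self))
      (fun t ht => hu.hasDerivWithinAt_laplaceOrbit hT (by simpa [hb] using ht.1.le))
      (intervalIntegrable_laplaceOrbit hT lam g hb).neg
    rw [laplaceOrbit_zero hT, intervalIntegral.integral_neg] at this
    rw [← neg_sub, ← this, neg_neg]
  have hleft : Tendsto (fun b : ℝ => ∫ t in (0 : ℝ)..b, laplaceOrbit T lam g t) atTop (𝓝 u) := by
    have := (tendsto_const_nhds (x := u)).sub (tendsto_laplaceOrbit_atTop hT hlam u)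
    rw [sub_zero] at this
    exact this.congr' ((eventually_ge_atTop 0).mono fun b hb => (hFTC b hb).symm)
  exact tendsto_nhds_unique hleft
    (intervalIntegral_tendsto_integral_Ioi 0 (integrableOn_laplaceOrbit hT hlam g) tendsto_id)

end Semigroup

/-! ### The hypergeometric series -/

section Hypergeometric

open Finset.HasAntidiagonal (antidiagonal)

/-- The Pochhammer symbol `(a)_n = a (a + 1) ⋯ (a + n - 1)`. -/
def poch {R : Type*} [Semiring R] (a : R) (n : ℕ) : R := (ascPochhammer R n).eval a

@[simp]
theorem poch_zero {R : Type*} [Semiring R] (a : R) : poch a 0 = 1 := by simp [poch]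

theorem poch_succ {R : Type*} [Semiring R] (a : R) (n : ℕ) : poch a (n + 1) = poch a n * (a + n) :=
  ascPochhammer_succ_eval n a

theorem poch_add {R : Type*} [CommSemiring R] (a : R) (k m : ℕ) :
    poch a (k + m) = poch a k * poch (a + k) m := by
  simp [poch, ← ascPochhammer_mul]

theorem poch_succ_left {R : Type*} [CommSemiring R] (a : R) (n : ℕ) :
    poch a (n + 1) = a * poch (a + 1) n := by
  simp [poch, ascPochhammer_succ_left]

theorem poch_pos {a : ℝ} (ha : 0 < a) (n : ℕ) : 0 < poch a n := ascPochhammer_pos n a ha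

theorem Gamma_add_natCast_eq_poch {x : ℝ} (hx : 0 < x) (k : ℕ) :
    Real.Gamma (x + k) = poch x k * Real.Gamma x := by
  induction k with
  | zero => simp
  | succ k ih =>
    rw [Nat.cast_succ, ← add_assoc, Real.Gamma_add_one (by positivity), ih, poch_succ]
    ring

theorem factorial_two_mul_eq_poch (k : ℕ) :
    ((2 * k).factorial : ℝ) = 4 ^ k * k.factorial * poch (1 / 2) k := by
  induction k with
  | zero => simp
  | succ k ih =>
    rw [show 2 * (k + 1) = 2 * k + 1 + 1 by ring, poch_succ]
    simp only [Nat.factorial_succ]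
    push_cast
    rw [ih]
    ring

theorem factorial_two_mul_add_one_eq_poch (k : ℕ) :
    ((2 * k + 1).factorial : ℝ) = 4 ^ k * k.factorial * poch (3 / 2) k := by
  have hshift : poch (1 / 2 : ℝ) k * (1 / 2 + k) = 1 / 2 * poch (3 / 2) k := by
    rw [← poch_succ, poch_succ_left]
    norm_num
  rw [Nat.factorial_succ, Nat.cast_mul, factorial_two_mul_eq_poch]
  push_cast
  linear_combination 2 * 4 ^ k * (k.factorial : ℝ) * hshift

theorem chu_vandermonde {R : Type*} [CommRing R] (n : ℕ) (a c : R) :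
    ∑ ij ∈ antidiagonal n, (n.choose ij.1 : R) *
      ((-1) ^ ij.1 * poch a ij.1 * poch (c + ij.1) ij.2) = poch (c - a) n := by
  induction n generalizing c with
  | zero => simp
  | succ n ih =>
    rw [Finset.sum_antidiagonal_choose_succ_mul
      (fun i j => (-1) ^ i * poch a i * poch (c + i) j : ℕ → ℕ → R), poch_succ_left,
      show c - a + 1 = c + 1 - a by ring, ← ih (c + 1), Finset.mul_sum, ← Finset.sum_add_distrib]
    refine Finset.sum_congr rfl fun ⟨i, j⟩ hij => ?_
    rw [Finset.HasAntidiagonal.mem_antidiagonal] at hij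
    simp only [← Nat.choose_symm_of_eq_add hij.symm, poch_succ_left (c + i), poch_succ a, pow_succ,
      Nat.cast_succ]
    rw [show c + (i : R) + 1 = c + 1 + i by ring, show c + ((i : R) + 1) = c + 1 + i by ring]
    ring

theorem hasSum_poch_div_factorial (b : ℝ) {x : ℝ} (hx : |x| < 1) :
    HasSum (fun m : ℕ => poch b m / m.factorial * x ^ m) ((1 / (1 - x)) ^ b) := by
  have h := (Real.one_div_one_sub_rpow_hasFPowerSeriesOnBall_zero b).hasSum (y := x)
    (by simpa [← ofReal_norm] using hx)
  rw [Real.div_rpow zero_le_one (by linarith [le_abs_self x]), Real.one_rpow]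
  rw [zero_add] at h
  refine h.congr_fun fun m => ?_
  rw [FormalMultilinearSeries.ofScalars_apply_eq, ← Ring.multichoose_eq, poch,
    ← Polynomial.ascPochhammer_smeval_eq_eval, ← Ring.factorial_nsmul_multichoose_eq_ascPochhammer,
    nsmul_eq_mul, smul_eq_mul]
  field_simp

theorem one_le_radius_ordinaryHypergeometricSeries (a b c : ℝ) :
    1 ≤ (ordinaryHypergeometricSeries ℝ a b c).radius := by
  by_cases h : ∀ k : ℕ, (k : ℝ) ≠ -a ∧ (k : ℝ) ≠ -b ∧ (k : ℝ) ≠ -c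
  · exact (ordinaryHypergeometricSeries_radius_eq_one (𝔸 := ℝ) a b c h).ge
  · push Not at h
    obtain ⟨k, hk⟩ := h
    have hradius : (ordinaryHypergeometricSeries ℝ a b c).radius = ⊤ := by
      by_cases ha : (k : ℝ) = -a
      · rw [show a = -(k : ℝ) by linarith]
        exact ordinaryHypergeometric_radius_top_of_neg_nat₁ ℝ b c
      by_cases hb : (k : ℝ) = -b
      · rw [show b = -(k : ℝ) by linarith]
        exact ordinaryHypergeometric_radius_top_of_neg_nat₂ ℝ a c
      · rw [show c = -(k : ℝ) by linarith [hk ha hb]]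
        exact ordinaryHypergeometric_radius_top_of_neg_nat₃ ℝ a b
    simp [hradius]

theorem summable_norm_ordinaryHypergeometricCoefficient (a b c : ℝ) {x : ℝ} (hx : |x| < 1) :
    Summable fun n : ℕ => ‖ordinaryHypergeometricCoefficient a b c n * x ^ n‖ := by
  refine ((ordinaryHypergeometricSeries ℝ a b c).summable_norm_apply (x := x)
    (Metric.eball_subset_eball (one_le_radius_ordinaryHypergeometricSeries a b c)
      (by simpa [← ofReal_norm] using hx))).congr fun n => ?_
  rw [ordinaryHypergeometricSeries_apply_eq, smul_eq_mul]

theorem hasSum_ordinaryHypergeometric (a b c : ℝ) {x : ℝ} (hx : |x| < 1) :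
    HasSum (fun n : ℕ => ordinaryHypergeometricCoefficient a b c n * x ^ n)
      (ordinaryHypergeometric a b c x) := by
  rw [ordinaryHypergeometric_eq_tsum]
  exact (summable_norm_ordinaryHypergeometricCoefficient a b c hx).of_norm.hasSum

/-- The terms of the double series in Pfaff's transformation: it is obtained by expanding the
factor `(1 - t)^{-(b+k)}` in the `k`-th term of `(1 - t)^{-b} ₂F₁(a, b; c; -t / (1 - t))`. -/
def pfaffTerm (a b c t : ℝ) (p : ℕ × ℕ) : ℝ :=
  ordinaryHypergeometricCoefficient a b c p.1 * (-t) ^ p.1 *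
    (poch (b + p.1) p.2 / p.2.factorial * t ^ p.2)

theorem hasSum_pfaffTerm_row (a b c : ℝ) {t : ℝ} (ht : |t| < 1) (k : ℕ) :
    HasSum (fun m => pfaffTerm a b c t (k, m)) ((1 / (1 - t)) ^ b *
      (ordinaryHypergeometricCoefficient a b c k * (-(t / (1 - t))) ^ k)) := by
  have h1t : 0 < 1 - t := by linarith [le_abs_self t]
  have hvalue : (1 / (1 - t)) ^ b * (ordinaryHypergeometricCoefficient a b c k *
      (-(t / (1 - t))) ^ k) =
        ordinaryHypergeometricCoefficient a b c k * (-t) ^ k * (1 / (1 - t)) ^ (b + k) := by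
    rw [Real.rpow_add (by positivity), Real.rpow_natCast,
      show -(t / (1 - t)) = -t * (1 / (1 - t)) by ring, mul_pow]
    ring
  rw [hvalue]
  exact (hasSum_poch_div_factorial (b + k) ht).mul_left _

theorem summable_pfaffTerm (a c : ℝ) {b t : ℝ} (hb : 0 < b) (ht0 : 0 ≤ t) (ht : t < 1 / 2) :
    Summable (pfaffTerm a b c t) := by
  have h1t : 0 < 1 - t := by linarith
  have hq : |-(t / (1 - t))| < 1 := by
    rw [abs_neg, abs_of_nonneg (by positivity), div_lt_one h1t]
    linarith
  have hrow (k : ℕ) : HasSum (fun m => ‖pfaffTerm a b c t (k, m)‖)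
      ((1 / (1 - t)) ^ b * ‖ordinaryHypergeometricCoefficient a b c k * (-(t / (1 - t))) ^ k‖) := by
    have hnorm : ‖ordinaryHypergeometricCoefficient a b c k * (-(t / (1 - t))) ^ k‖ =
        ‖ordinaryHypergeometricCoefficient a b c k * (-t) ^ k‖ * (1 / (1 - t)) ^ k := by
      rw [show -(t / (1 - t)) = -t * (1 / (1 - t)) by ring, mul_pow, ← mul_assoc, norm_mul,
        Real.norm_of_nonneg (by positivity : 0 ≤ (1 / (1 - t)) ^ k)]
    rw [hnorm, mul_left_comm, ← Real.rpow_natCast (1 / (1 - t)), ← Real.rpow_add (by positivity)]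
    refine ((hasSum_poch_div_factorial (b + k) (abs_lt.2 ⟨by linarith, by linarith⟩)).mul_left
      _).congr_fun fun m => ?_
    have := poch_pos (by positivity : 0 < b + k) m
    rw [pfaffTerm, norm_mul, Real.norm_of_nonneg (by positivity : 0 ≤ poch (b + k) m / _ * t ^ m)]
  refine Summable.of_norm ?_
  rw [summable_prod_of_nonneg fun _ => norm_nonneg _]
  refine ⟨fun k => (hrow k).summable, ?_⟩
  simp only [fun k => (hrow k).tsum_eq]
  exact (summable_norm_ordinaryHypergeometricCoefficient a b c hq).mul_left _

theorem sum_antidiagonal_pfaffTerm (a b t : ℝ) {c : ℝ} (hc : ∀ n, poch c n ≠ 0) (n : ℕ) :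
    ∑ p ∈ antidiagonal n, pfaffTerm a b c t p =
      ordinaryHypergeometricCoefficient (c - a) b c n * t ^ n := by
  change _ = (n.factorial : ℝ)⁻¹ * poch (c - a) n * poch b n * (poch c n)⁻¹ * t ^ n
  rw [← chu_vandermonde n a c]
  simp only [Finset.mul_sum, Finset.sum_mul]
  refine Finset.sum_congr rfl fun ⟨k, m⟩ hkm => ?_
  obtain rfl : k + m = n := Finset.HasAntidiagonal.mem_antidiagonal.1 hkm
  change (k.factorial : ℝ)⁻¹ * poch a k * poch b k * (poch c k)⁻¹ * (-t) ^ k *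
    (poch (b + k) m / m.factorial * t ^ m) = _
  have hck := hc (k + m)
  rw [poch_add] at hck
  have hk := left_ne_zero_of_mul hck
  have hm := right_ne_zero_of_mul hck
  rw [poch_add b, poch_add c, Nat.choose_symm_add, Nat.add_choose,
    Nat.cast_div (Nat.factorial_mul_factorial_dvd_factorial_add k m) (by positivity), neg_pow]
  push_cast
  field_simp
  ring

theorem pfaff_transformation (a : ℝ) {b c t : ℝ} (hb : 0 < b) (hc : ∀ n, poch c n ≠ 0)
    (ht0 : 0 ≤ t) (ht : t < 1 / 2) :
    HasSum (fun n : ℕ => ordinaryHypergeometricCoefficient (c - a) b c n * t ^ n)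
      ((1 / (1 - t)) ^ b * ordinaryHypergeometric a b c (-(t / (1 - t)))) := by
  have h1t : 0 < 1 - t := by linarith
  have hq : |-(t / (1 - t))| < 1 := by
    rw [abs_neg, abs_of_nonneg (by positivity), div_lt_one h1t]
    linarith
  have hsum := (summable_pfaffTerm a c hb ht0 ht).hasSum
  have hrows := hsum.prod_fiberwise
    (hasSum_pfaffTerm_row a b c (abs_lt.2 ⟨by linarith, by linarith⟩))
  rw [hrows.unique ((hasSum_ordinaryHypergeometric a b c hq).mul_left _),
    ← Finset.HasAntidiagonal.sigmaAntidiagonalEquivProd.hasSum_iff] at hsum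
  refine (hsum.sigma fun n => hasSum_fintype _).congr_fun fun n => ?_
  rw [← sum_antidiagonal_pfaffTerm a b t hc n, Finset.univ_eq_attach]
  exact (Finset.sum_attach _ _).symm

theorem hasSum_hyp2F1 (a : ℝ) {b c t : ℝ} (hb : 0 < b) (hc : ∀ n, poch c n ≠ 0) (ht0 : 0 ≤ t)
    (ht : t < 1) :
    HasSum (fun n : ℕ => ordinaryHypergeometricCoefficient (c - a) b c n * t ^ n)
      ((1 / (1 - t)) ^ b * hyp2F1 a b c (-(t / (1 - t)))) := by
  have h1t : 0 < 1 - t := by linarith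
  unfold hyp2F1
  split_ifs with h
  · refine pfaff_transformation a hb hc ht0 ?_
    rw [abs_neg, abs_of_nonneg (by positivity), div_lt_one h1t] at h
    linarith
  · have hbase : 1 - -(t / (1 - t)) = 1 / (1 - t) := by field_simp; ring
    have harg : -(t / (1 - t)) / (-(t / (1 - t)) - 1) = t := by
      rw [show -(t / (1 - t)) - 1 = -(1 / (1 - t)) by linarith]
      field_simp
    rw [hbase, harg, ← mul_assoc, ← Real.rpow_add (by positivity), add_neg_cancel, Real.rpow_zero,
      one_mul]
    exact hasSum_ordinaryHypergeometric _ b c (by rwa [abs_of_nonneg ht0])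

/-- The terms `2ⁿ t^{n/2} Γ(r + n/2) Γ(p + n/2) / n!` which arise from the moments of a Gaussian
times a growing exponential. -/
def expMomentTerm (p r t : ℝ) (n : ℕ) : ℝ :=
  2 ^ n * t ^ ((n : ℝ) / 2) * Real.Gamma (r + n / 2) * Real.Gamma (p + n / 2) / n.factorial

/-- The closed form of `∑ₙ expMomentTerm p r t n`. -/
def expMoment (p r t : ℝ) : ℝ :=
  Real.Gamma r * Real.Gamma p *
      ((1 / (1 - t)) ^ r * hyp2F1 (1 / 2 - p) r (1 / 2) (-(t / (1 - t)))) +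
    2 * t ^ ((1 : ℝ) / 2) * Real.Gamma (r + 1 / 2) * Real.Gamma (p + 1 / 2) *
      ((1 / (1 - t)) ^ (r + 1 / 2) *
        hyp2F1 (1 - p) (r + 1 / 2) (3 / 2) (-(t / (1 - t))))

theorem expMomentTerm_nonneg {p r t : ℝ} (hp : 0 < p) (hr : 0 < r) (ht : 0 < t) (n : ℕ) :
    0 ≤ expMomentTerm p r t n := by
  have := Real.Gamma_pos_of_pos (by positivity : 0 < r + n / 2)
  have := Real.Gamma_pos_of_pos (by positivity : 0 < p + n / 2)
  unfold expMomentTerm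
  positivity

-- The even and the odd part of the series are hypergeometric, by the duplication formulas for
-- `(2k)!` and `(2k+1)!`.
theorem hasSum_expMomentTerm {p r t : ℝ} (hp : 0 < p) (hr : 0 < r) (ht0 : 0 < t) (ht : t < 1) :
    HasSum (expMomentTerm p r t) (expMoment p r t) := by
  have hhalf (k : ℕ) : poch (1 / 2 : ℝ) k ≠ 0 := (poch_pos (by norm_num) k).ne'
  have hthreeHalves (k : ℕ) : poch (3 / 2 : ℝ) k ≠ 0 := (poch_pos (by norm_num) k).ne'
  refine HasSum.even_add_odd ?_ ?_
  · refine ((hasSum_hyp2F1 (1 / 2 - p) hr hhalf ht0.le ht).mul_left _).congr_fun fun k => ?_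
    have := hhalf k
    change expMomentTerm p r t (2 * k) = _ * ((k.factorial : ℝ)⁻¹ *
      poch (1 / 2 - (1 / 2 - p)) k * poch r k * (poch (1 / 2) k)⁻¹ * t ^ k)
    rw [expMomentTerm, show ((2 * k : ℕ) : ℝ) / 2 = k by push_cast; ring,
      Gamma_add_natCast_eq_poch hr,
      Gamma_add_natCast_eq_poch hp, factorial_two_mul_eq_poch, Real.rpow_natCast, sub_sub_cancel,
      pow_mul, show (2 : ℝ) ^ 2 = 4 by norm_num]
    field_simp
  · refine ((hasSum_hyp2F1 (1 - p) (by positivity : 0 < r + 1 / 2) hthreeHalves ht0.le ht).mul_left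
      _).congr_fun fun k => ?_
    have := hthreeHalves k
    change expMomentTerm p r t (2 * k + 1) = _ * ((k.factorial : ℝ)⁻¹ *
      poch (3 / 2 - (1 - p)) k * poch (r + 1 / 2) k * (poch (3 / 2) k)⁻¹ * t ^ k)
    rw [expMomentTerm, show ((2 * k + 1 : ℕ) : ℝ) / 2 = 1 / 2 + k by push_cast; ring,
      ← add_assoc, ← add_assoc,
      Gamma_add_natCast_eq_poch (by positivity), Gamma_add_natCast_eq_poch (by positivity),
      factorial_two_mul_add_one_eq_poch, Real.rpow_add ht0, Real.rpow_natCast,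
      show 3 / 2 - (1 - p) = p + 1 / 2 by ring, pow_succ, pow_mul, show (2 : ℝ) ^ 2 = 4 by norm_num]
    field_simp

theorem expMoment_nonneg {p r t : ℝ} (hp : 0 < p) (hr : 0 < r) (ht0 : 0 < t) (ht : t < 1) :
    0 ≤ expMoment p r t :=
  (hasSum_expMomentTerm hp hr ht0 ht).nonneg (expMomentTerm_nonneg hp hr ht0)

end Hypergeometric

/-! ### Gaussian moments and Laplace transforms of weights -/

section GaussianMoments

variable {E : Type*} [NormedAddCommGroup E] [InnerProductSpace ℝ E] [FiniteDimensional ℝ E]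
  [MeasurableSpace E] [BorelSpace E] [Nontrivial E] {d : ℕ} {K : ℝ}

/-- The `n`-th absolute moment `∫ ‖y‖ⁿ e^{-‖y‖² / (4K)} dy` of a Gaussian in dimension `d`. -/
def gaussMoment (d n : ℕ) (K : ℝ) : ℝ :=
  (4 * K) ^ (((d : ℝ) + n) / 2) * Real.pi ^ ((d : ℝ) / 2) * Real.Gamma (((d : ℝ) + n) / 2) /
    Real.Gamma ((d : ℝ) / 2)

theorem gaussMoment_pos (hd : 0 < d) (n : ℕ) (hK : 0 < K) : 0 < gaussMoment d n K := by
  have : (0 : ℝ) < d := Nat.cast_pos.2 hd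
  have := Real.Gamma_pos_of_pos (by positivity : 0 < (d : ℝ) / 2)
  have := Real.Gamma_pos_of_pos (by positivity : 0 < ((d : ℝ) + n) / 2)
  unfold gaussMoment
  positivity

theorem volume_real_ball_zero_one (hE : Module.finrank ℝ E = d) :
    (volume : Measure E).real (Metric.ball 0 1) =
      Real.pi ^ ((d : ℝ) / 2) / Real.Gamma ((d : ℝ) / 2 + 1) := by
  have hπ : √Real.pi ^ d = Real.pi ^ ((d : ℝ) / 2) := by
    rw [Real.sqrt_eq_rpow, ← Real.rpow_natCast, ← Real.rpow_mul Real.pi_pos.le]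
    congr 1
    ring
  have := Real.Gamma_pos_of_pos (by positivity : (0 : ℝ) < (d : ℝ) / 2 + 1)
  rw [Measure.real, InnerProductSpace.volume_ball, hE, hπ, ENNReal.ofReal_one, one_pow, one_mul,
    ENNReal.toReal_ofReal (by positivity)]

theorem integral_pow_mul_pow_mul_exp (hd : 0 < d) (n : ℕ) (hK : 0 < K) :
    ∫ s in Set.Ioi (0 : ℝ), s ^ (d - 1) • (s ^ n * Real.exp (-s ^ 2 / (4 * K))) =
      (4 * K) ^ (((d : ℝ) + n) / 2) * (1 / 2) * Real.Gamma (((d : ℝ) + n) / 2) := by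
  have hd' : (0 : ℝ) < d := Nat.cast_pos.2 hd
  have hGamma := integral_rpow_mul_exp_neg_mul_rpow (p := 2) (q := (d : ℝ) + n - 1)
    (b := 1 / (4 * K)) two_pos (by linarith [(n.cast_nonneg : (0 : ℝ) ≤ n)]) (by positivity)
  rw [show -((d : ℝ) + n - 1 + 1) / 2 = -(((d : ℝ) + n) / 2) by ring, sub_add_cancel,
    Real.rpow_neg (by positivity), one_div (4 * K), Real.inv_rpow (by positivity), inv_inv]
    at hGamma
  rw [← hGamma]
  refine setIntegral_congr_fun measurableSet_Ioi fun s _ => ?_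
  have hexponent : (d : ℝ) + n - 1 = ((d - 1 + n : ℕ) : ℝ) := by
    push_cast [Nat.cast_sub (Nat.one_le_iff_ne_zero.2 hd.ne')]
    ring
  simp only [hexponent, Real.rpow_natCast, Real.rpow_two, smul_eq_mul, pow_add]
  rw [mul_assoc]
  congr 3
  field_simp

theorem integral_norm_pow_mul_exp (hE : Module.finrank ℝ E = d) (n : ℕ) (hK : 0 < K) :
    ∫ y : E, ‖y‖ ^ n * Real.exp (-‖y‖ ^ 2 / (4 * K)) = gaussMoment d n K := by
  have hd : 0 < d := hE ▸ Module.finrank_pos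
  have : (0 : ℝ) < d := Nat.cast_pos.2 hd
  have := Real.Gamma_pos_of_pos (by positivity : (0 : ℝ) < (d : ℝ) / 2)
  rw [integral_fun_norm_addHaar volume fun s : ℝ => s ^ n * Real.exp (-s ^ 2 / (4 * K)), hE,
    volume_real_ball_zero_one hE, integral_pow_mul_pow_mul_exp hd n hK,
    Real.Gamma_add_one (by positivity), nsmul_eq_mul, smul_eq_mul, gaussMoment]
  field_simp

theorem integrable_norm_pow_mul_exp {V : Type*} [NormedAddCommGroup V] [InnerProductSpace ℝ V]
    [FiniteDimensional ℝ V] [MeasurableSpace V] [BorelSpace V] (n : ℕ) (hK : 0 < K) :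
    Integrable fun y : V => ‖y‖ ^ n * Real.exp (-‖y‖ ^ 2 / (4 * K)) := by
  rcases subsingleton_or_nontrivial V with _ | _
  · exact (by fun_prop : Continuous fun y : V =>
      ‖y‖ ^ n * Real.exp (-‖y‖ ^ 2 / (4 * K))).integrable_of_hasCompactSupport
        (.of_compactSpace _)
  · refine .of_integral_ne_zero ?_
    rw [integral_norm_pow_mul_exp rfl n hK]
    exact (gaussMoment_pos Module.finrank_pos n hK).ne'

theorem lintegral_norm_pow_mul_exp (hE : Module.finrank ℝ E = d) (n : ℕ) (hK : 0 < K) :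
    ∫⁻ y : E, ENNReal.ofReal (‖y‖ ^ n * Real.exp (-‖y‖ ^ 2 / (4 * K))) =
      ENNReal.ofReal (gaussMoment d n K) := by
  rw [← ofReal_integral_eq_lintegral_ofReal (integrable_norm_pow_mul_exp n hK)
    (Eventually.of_forall fun y => by positivity), integral_norm_pow_mul_exp hE n hK]

theorem integrableOn_rpow_mul_exp_neg {a w : ℝ} (ha : 0 < a) (hw : 0 < w) :
    IntegrableOn (fun t : ℝ => t ^ (a - 1) * Real.exp (-(w * t))) (Set.Ioi 0) := by
  refine .of_integral_ne_zero ?_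
  rw [Real.integral_rpow_mul_exp_neg_mul_Ioi ha hw]
  have := Real.Gamma_pos_of_pos ha
  positivity

theorem lintegral_rpow_mul_exp_neg {a w : ℝ} (ha : 0 < a) (hw : 0 < w) :
    ∫⁻ t in Set.Ioi (0 : ℝ), ENNReal.ofReal (t ^ (a - 1) * Real.exp (-(w * t))) =
      ENNReal.ofReal ((1 / w) ^ a * Real.Gamma a) := by
  rw [← ofReal_integral_eq_lintegral_ofReal (integrableOn_rpow_mul_exp_neg ha hw),
    Real.integral_rpow_mul_exp_neg_mul_Ioi ha hw]
  filter_upwards [ae_restrict_mem measurableSet_Ioi] with t (ht : 0 < t)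
  positivity

theorem lintegral_norm_pow_mul_exp_norm_mul_exp (hE : Module.finrank ℝ E = d) (m : ℕ) (hK : 0 < K)
    {c : ℝ} (hc : 0 ≤ c) :
    ∫⁻ y : E, ENNReal.ofReal (‖y‖ ^ m * Real.exp (c * ‖y‖) * Real.exp (-‖y‖ ^ 2 / (4 * K))) =
      ∑' n : ℕ, ENNReal.ofReal (c ^ n / n.factorial * gaussMoment d (m + n) K) := by
  have hexpand (y : E) :
      ENNReal.ofReal (‖y‖ ^ m * Real.exp (c * ‖y‖) * Real.exp (-‖y‖ ^ 2 / (4 * K))) =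
        ∑' n : ℕ, ENNReal.ofReal (c ^ n / n.factorial) *
          ENNReal.ofReal (‖y‖ ^ (m + n) * Real.exp (-‖y‖ ^ 2 / (4 * K))) := by
    have hsum := (Real.exp_eq_exp_ℝ ▸ NormedSpace.expSeries_div_hasSum_exp (c * ‖y‖)).mul_left
      (‖y‖ ^ m * Real.exp (-‖y‖ ^ 2 / (4 * K)))
    rw [mul_right_comm, ← hsum.tsum_eq, ENNReal.ofReal_tsum_of_nonneg
      (fun n => by positivity) hsum.summable]
    refine tsum_congr fun n => ?_
    rw [← ENNReal.ofReal_mul (by positivity)]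
    congr 1
    ring
  simp_rw [hexpand]
  rw [lintegral_tsum fun n => by fun_prop]
  refine tsum_congr fun n => ?_
  rw [lintegral_const_mul' _ _ ENNReal.ofReal_ne_top, lintegral_norm_pow_mul_exp hE _ hK,
    ENNReal.ofReal_mul (by positivity)]

theorem lintegral_rpow_mul_exp_mul_lintegral_eq_tsum (hE : Module.finrank ℝ E = d) (m : ℕ)
    (hK : 0 < K) {w η r : ℝ} (hw : 0 < w) (hη : 0 ≤ η) (hr : 0 < r) :
    ∫⁻ t in Set.Ioi (0 : ℝ), ENNReal.ofReal (t ^ (r - 1) * Real.exp (-(w * t))) *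
        ∫⁻ y : E, ENNReal.ofReal
          (‖y‖ ^ m * Real.exp (η * √t * ‖y‖) * Real.exp (-‖y‖ ^ 2 / (4 * K))) =
      ∑' n : ℕ, ENNReal.ofReal (η ^ n / n.factorial * gaussMoment d (m + n) K *
        ((1 / w) ^ (r + n / 2) * Real.Gamma (r + n / 2))) := by
  have hcoeff (n : ℕ) : 0 ≤ η ^ n / n.factorial * gaussMoment d (m + n) K :=
    mul_nonneg (by positivity) (gaussMoment_pos (hE ▸ Module.finrank_pos) _ hK).le
  have hexpand : ∀ t ∈ Set.Ioi (0 : ℝ), ENNReal.ofReal (t ^ (r - 1) * Real.exp (-(w * t))) *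
      ∫⁻ y : E, ENNReal.ofReal
        (‖y‖ ^ m * Real.exp (η * √t * ‖y‖) * Real.exp (-‖y‖ ^ 2 / (4 * K))) =
      ∑' n : ℕ, ENNReal.ofReal (η ^ n / n.factorial * gaussMoment d (m + n) K) *
        ENNReal.ofReal (t ^ (r + n / 2 - 1) * Real.exp (-(w * t))) := by
    intro t (ht : 0 < t)
    rw [lintegral_norm_pow_mul_exp_norm_mul_exp hE m hK (by positivity), ← ENNReal.tsum_mul_left]
    refine tsum_congr fun n => ?_
    rw [← ENNReal.ofReal_mul (by positivity), ← ENNReal.ofReal_mul (hcoeff n),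
      show r + n / 2 - 1 = r - 1 + 1 / 2 * n by ring, Real.rpow_add ht, Real.rpow_mul ht.le,
      Real.rpow_natCast, ← Real.sqrt_eq_rpow, mul_pow]
    congr 1
    ring
  rw [setLIntegral_congr_fun measurableSet_Ioi hexpand, lintegral_tsum fun n => by fun_prop]
  refine tsum_congr fun n => ?_
  rw [lintegral_const_mul' _ _ ENNReal.ofReal_ne_top, lintegral_rpow_mul_exp_neg (by positivity) hw,
    ENNReal.ofReal_mul (hcoeff n)]

theorem pow_mul_rpow_mul_gaussMoment_le (hd : 0 < d) (m n : ℕ) {w η ϑ r : ℝ} (hK : 0 < K)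
    (hw : 0 < w) (hη0 : 0 ≤ η) (hη : η ^ 2 * K ≤ ϑ * w) (hr : 0 < r) :
    η ^ n / n.factorial * gaussMoment d (m + n) K *
        ((1 / w) ^ (r + n / 2) * Real.Gamma (r + n / 2)) ≤
      (1 / w) ^ r * Real.pi ^ ((d : ℝ) / 2) * (4 * K) ^ (((d : ℝ) + m) / 2) /
        Real.Gamma ((d : ℝ) / 2) * expMomentTerm (((d : ℝ) + m) / 2) r ϑ n := by
  have : (0 : ℝ) < d := Nat.cast_pos.2 hd
  have := Real.Gamma_pos_of_pos (by positivity : (0 : ℝ) < (d : ℝ) / 2)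
  have := Real.Gamma_pos_of_pos (by positivity : (0 : ℝ) < r + n / 2)
  have := Real.Gamma_pos_of_pos (by positivity : (0 : ℝ) < ((d : ℝ) + m) / 2 + n / 2)
  have hfour : (4 * K) ^ ((n : ℝ) / 2) = 2 ^ n * K ^ ((n : ℝ) / 2) := by
    rw [Real.mul_rpow (by norm_num) hK.le, show (4 : ℝ) = 2 ^ (2 : ℝ) by norm_num,
      ← Real.rpow_mul (by norm_num), mul_div_cancel₀ _ two_ne_zero, Real.rpow_natCast]
  have hrate : η ^ n * (1 / w) ^ ((n : ℝ) / 2) * K ^ ((n : ℝ) / 2) ≤ ϑ ^ ((n : ℝ) / 2) := by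
    have hsq : η ^ n = (η ^ 2) ^ ((n : ℝ) / 2) := by
      rw [← Real.rpow_two, ← Real.rpow_mul hη0, mul_div_cancel₀ _ two_ne_zero, Real.rpow_natCast]
    rw [hsq, ← Real.mul_rpow (by positivity) (by positivity),
      ← Real.mul_rpow (by positivity) (by positivity)]
    refine Real.rpow_le_rpow (by positivity) ?_ (by positivity)
    rwa [mul_one_div, div_mul_eq_mul_div, div_le_iff₀ hw]
  rw [gaussMoment, expMomentTerm,
    show ((d : ℝ) + (m + n : ℕ)) / 2 = ((d : ℝ) + m) / 2 + n / 2 by push_cast; ring,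
    Real.rpow_add (by positivity), Real.rpow_add (by positivity), hfour]
  calc _ = (1 / w) ^ r * Real.pi ^ ((d : ℝ) / 2) * (4 * K) ^ (((d : ℝ) + m) / 2) /
      Real.Gamma ((d : ℝ) / 2) * (2 ^ n * (η ^ n * (1 / w) ^ ((n : ℝ) / 2) * K ^ ((n : ℝ) / 2)) *
        Real.Gamma (r + n / 2) * Real.Gamma (((d : ℝ) + m) / 2 + n / 2) / n.factorial) := by ring
    _ ≤ _ := by gcongr

theorem lintegral_rpow_mul_exp_mul_lintegral_le (hE : Module.finrank ℝ E = d) (m : ℕ)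
    (hK : 0 < K) {w η ϑ r : ℝ} (hw : 0 < w) (hη0 : 0 ≤ η) (hη : η ^ 2 * K ≤ ϑ * w) (hϑ0 : 0 < ϑ)
    (hϑ : ϑ < 1) (hr : 0 < r) :
    ∫⁻ t in Set.Ioi (0 : ℝ), ENNReal.ofReal (t ^ (r - 1) * Real.exp (-(w * t))) *
        ∫⁻ y : E, ENNReal.ofReal
          (‖y‖ ^ m * Real.exp (η * √t * ‖y‖) * Real.exp (-‖y‖ ^ 2 / (4 * K))) ≤
      ENNReal.ofReal ((1 / w) ^ r * Real.pi ^ ((d : ℝ) / 2) * (4 * K) ^ (((d : ℝ) + m) / 2) /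
        Real.Gamma ((d : ℝ) / 2) * expMoment (((d : ℝ) + m) / 2) r ϑ) := by
  have hd : 0 < d := hE ▸ Module.finrank_pos
  have : (0 : ℝ) < d := Nat.cast_pos.2 hd
  have hp : 0 < ((d : ℝ) + m) / 2 := by positivity
  have := Real.Gamma_pos_of_pos (by positivity : (0 : ℝ) < (d : ℝ) / 2)
  have hsum := (hasSum_expMomentTerm hp hr hϑ0 hϑ).mul_left ((1 / w) ^ r *
    Real.pi ^ ((d : ℝ) / 2) * (4 * K) ^ (((d : ℝ) + m) / 2) / Real.Gamma ((d : ℝ) / 2))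
  rw [lintegral_rpow_mul_exp_mul_lintegral_eq_tsum hE m hK hw hη0 hr, ← hsum.tsum_eq,
    ENNReal.ofReal_tsum_of_nonneg (fun n => mul_nonneg (by positivity)
      (expMomentTerm_nonneg hp hr hϑ0 n)) hsum.summable]
  exact ENNReal.tsum_le_tsum fun n =>
    ENNReal.ofReal_le_ofReal (pow_mul_rpow_mul_gaussMoment_le hd m n hK hw hη0 hη hr)

end GaussianMoments

/-! ### Simultaneous diagonalization and rotations -/

section Matrices

section ConjDiag

variable {n : Type*} [Fintype n] [DecidableEq n] {K : Type*} [Field K] {Y : Matrix n n K}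

/-- The algebra homomorphism `c ↦ Y diag(c) Y⁻¹`. -/
def conjDiag (hY : IsUnit Y) : (n → K) →ₐ[K] Matrix n n K :=
  (MulSemiringAction.toAlgHom K _ (ConjAct.toConjAct hY.unit)).comp (Matrix.diagonalAlgHom K)

theorem conjDiag_apply (hY : IsUnit Y) (c : n → K) :
    conjDiag hY c = Y * Matrix.diagonal c * Y⁻¹ := by
  simp [conjDiag, ConjAct.units_smul_def, Matrix.coe_units_inv]

theorem eq_conjDiag (hY : IsUnit Y) {A : Matrix n n K} (hA : (Y⁻¹ * A * Y).IsDiag) :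
    A = conjDiag hY (Y⁻¹ * A * Y).diag := by
  have hdet := (Matrix.isUnit_iff_isUnit_det Y).1 hY
  rw [conjDiag_apply, hA.diagonal_diag,
    show Y * (Y⁻¹ * A * Y) * Y⁻¹ = Y * Y⁻¹ * A * (Y * Y⁻¹) by simp only [mul_assoc],
    Matrix.mul_nonsing_inv Y hdet, one_mul, mul_one]

theorem spectrum_conjDiag (hY : IsUnit Y) (c : n → K) :
    spectrum K (conjDiag hY c) = Set.range c := by
  rw [conjDiag_apply]
  obtain ⟨u, rfl⟩ := hY
  rw [← Matrix.coe_units_inv, spectrum.units_conjugate, spectrum_diagonal]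

theorem inv_conjDiag (hY : IsUnit Y) {c : n → K} (hc : ∀ j, c j ≠ 0) :
    (conjDiag hY c)⁻¹ = conjDiag hY c⁻¹ := by
  refine Matrix.inv_eq_right_inv ?_
  rw [← map_mul, ← map_one (conjDiag hY)]
  congr 1
  ext j
  simp [hc j]

end ConjDiag

variable {N : ℕ} {A B Y : Matrix (Fin N) (Fin N) ℂ}

theorem exp_conjDiag (hY : IsUnit Y) (c : Fin N → ℂ) :
    NormedSpace.exp (conjDiag hY c) = conjDiag hY fun j => Complex.exp (c j) := by
  rw [conjDiag_apply, Matrix.exp_conj _ _ hY, Matrix.exp_diagonal, conjDiag_apply]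
  congr 3
  ext j
  rw [Pi.coe_exp, Complex.exp_eq_exp_ℂ]

theorem matCPow_conjDiag (hY : IsUnit Y) (c : Fin N → ℂ) (s : ℂ) :
    matCPow (conjDiag hY c) s = conjDiag hY fun j => c j ^ s := by
  classical
  rw [matCPow, Polynomial.aeval_algHom_apply]
  congr 1
  ext j
  rw [Polynomial.aeval_fn_apply, Polynomial.coe_aeval_eq_eval]
  refine Lagrange.eval_interpolate_at_node _ (fun _ _ _ _ h => h) ?_
  rw [Multiset.mem_toFinset, Polynomial.mem_roots (Matrix.charpoly_monic _).ne_zero,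
    ← Matrix.mem_spectrum_iff_isRoot_charpoly, spectrum_conjDiag]
  exact Set.mem_range_self j

theorem rho_conjDiag (hY : IsUnit Y) (c : Fin N → ℂ) : rho (conjDiag hY c) = ⨆ j, ‖c j‖ := by
  rw [rho, spectralRadius, spectrum_conjDiag, iSup_range,
    ENNReal.toReal_iSup fun _ => ENNReal.coe_ne_top]
  simp

theorem abscissa_conjDiag (hY : IsUnit Y) (c : Fin N → ℂ) :
    abscissa (conjDiag hY c) = ⨆ j, (c j).re := by
  rw [abscissa, spectrum_conjDiag, ← Set.range_comp]
  rfl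

/-- `A` and `B` are diagonalized by `Y`, with eigenvalues `a` and `b` along its columns, and those
of `A` have positive real part. -/
structure SpectralData (A B Y : Matrix (Fin N) (Fin N) ℂ) (a b : Fin N → ℂ) : Prop where
  isUnit : IsUnit Y
  eq_left : A = conjDiag isUnit a
  eq_right : B = conjDiag isUnit b
  re_pos : ∀ j, 0 < (a j).re

theorem exists_spectralData (h : SimDiagonalizable A B Y) (hA : ∀ z ∈ spectrum ℂ A, 0 < z.re) :
    ∃ a b, SpectralData A B Y a b := by
  obtain ⟨hY, hdiagA, hdiagB⟩ := h
  refine ⟨_, _, hY, eq_conjDiag hY hdiagA, eq_conjDiag hY hdiagB, fun j => hA _ ?_⟩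
  have hspec := spectrum_conjDiag hY (Y⁻¹ * A * Y).diag
  rw [← eq_conjDiag hY hdiagA] at hspec
  exact hspec ▸ Set.mem_range_self j

namespace SpectralData

variable {a b : Fin N → ℂ} (h : SpectralData A B Y a b)
include h

theorem ne_zero (j : Fin N) : a j ≠ 0 := fun h0 => by simpa [h0] using h.re_pos j

theorem aMax_eq : aMax A = ⨆ j, ‖a j‖ := by
  obtain ⟨hY, rfl, -, -⟩ := h
  exact rho_conjDiag hY a

theorem aMin_eq : aMin A = (⨆ j, ‖a j‖⁻¹)⁻¹ := by
  have ha := h.ne_zero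
  obtain ⟨hY, rfl, -, -⟩ := h
  rw [aMin, inv_conjDiag hY ha, rho_conjDiag]
  simp only [Pi.inv_apply, norm_inv]

theorem aZero_eq : aZero A = -⨆ j, -(a j).re := by
  obtain ⟨hY, rfl, -, -⟩ := h
  rw [aZero, ← map_neg, abscissa_conjDiag]
  rfl

theorem bZero_eq : bZero B = -⨆ j, -(b j).re := by
  obtain ⟨hY, -, rfl, -⟩ := h
  rw [bZero, ← map_neg, abscissa_conjDiag]
  rfl

theorem le_aMax (j : Fin N) : ‖a j‖ ≤ aMax A :=
  h.aMax_eq ▸ le_ciSup (f := fun j => ‖a j‖) (Set.finite_range _).bddAbove j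

theorem aMin_le (j : Fin N) : aMin A ≤ ‖a j‖ := by
  rw [h.aMin_eq]
  exact inv_le_of_inv_le₀ (norm_pos_iff.2 (h.ne_zero j))
    (le_ciSup (f := fun j => ‖a j‖⁻¹) (Set.finite_range _).bddAbove j)

theorem aZero_le (j : Fin N) : aZero A ≤ (a j).re := by
  rw [h.aZero_eq]
  exact neg_le.1 (le_ciSup (f := fun j => -(a j).re) (Set.finite_range _).bddAbove j)

theorem neg_re_le_omegaB (j : Fin N) : -(b j).re ≤ omegaB B := by
  rw [omegaB, h.bZero_eq, neg_neg]
  exact le_ciSup (f := fun j => -(b j).re) (Set.finite_range _).bddAbove j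

variable [NeZero N]

theorem aMax_pos : 0 < aMax A := (norm_pos_iff.2 (h.ne_zero 0)).trans_le (h.le_aMax 0)

theorem aMin_pos : 0 < aMin A := by
  obtain ⟨j, hj⟩ := exists_eq_ciSup_of_finite (f := fun j => ‖a j‖⁻¹)
  rw [h.aMin_eq, ← hj, inv_inv]
  exact norm_pos_iff.2 (h.ne_zero j)

theorem aZero_pos : 0 < aZero A := by
  obtain ⟨j, hj⟩ := exists_eq_ciSup_of_finite (f := fun j => -(a j).re)
  rw [h.aZero_eq, ← hj, neg_neg]
  exact h.re_pos j

end SpectralData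

/-- The operator on `ℂ^N` with matrix `Y diag(c) Y⁻¹`. -/
def multiplier (Y : Matrix (Fin N) (Fin N) ℂ) (c : Fin N → ℂ) : CN N →L[ℂ] CN N :=
  Matrix.toEuclideanCLM (n := Fin N) (𝕜 := ℂ) (Y * Matrix.diagonal c * Y⁻¹)

theorem multiplier_eq (hY : IsUnit Y) (c : Fin N → ℂ) :
    multiplier Y c = Matrix.toEuclideanCLM (n := Fin N) (𝕜 := ℂ) (conjDiag hY c) := by
  rw [multiplier, conjDiag_apply]

theorem cond_nonneg (Y : Matrix (Fin N) (Fin N) ℂ) : 0 ≤ cond Y :=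
  mul_nonneg (norm_nonneg _) (norm_nonneg _)

theorem norm_multiplier_le (Y : Matrix (Fin N) (Fin N) ℂ) {c : Fin N → ℂ} {C : ℝ} (hC : 0 ≤ C)
    (hc : ∀ j, ‖c j‖ ≤ C) : ‖multiplier Y c‖ ≤ cond Y * C := by
  have hdiag : ‖Matrix.toEuclideanCLM (n := Fin N) (𝕜 := ℂ) (Matrix.diagonal c)‖ ≤ C := by
    rw [Matrix.l2_opNorm_toEuclideanCLM, Matrix.l2_opNorm_diagonal]
    exact (pi_norm_le_iff_of_nonneg hC).2 hc
  rw [multiplier, map_mul, map_mul, cond, specNorm, specNorm, mul_right_comm]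
  exact (norm_mul_le _ _).trans (mul_le_mul_of_nonneg_right
    ((norm_mul_le _ _).trans (mul_le_mul_of_nonneg_left hdiag (norm_nonneg _))) (norm_nonneg _))

/-- The spectral projection of `ℂ^N` onto the line spanned by the `j`-th column of `Y`. -/
def specProj (Y : Matrix (Fin N) (Fin N) ℂ) (j : Fin N) : CN N →L[ℂ] CN N :=
  multiplier Y (Pi.single j 1)

theorem specProj_mul_specProj (hY : IsUnit Y) (i j : Fin N) :
    specProj Y i * specProj Y j = if i = j then specProj Y i else 0 := by
  have hsingle :
      (Pi.single i 1 * Pi.single j 1 : Fin N → ℂ) = if i = j then Pi.single i 1 else 0 := by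
    split_ifs with hij
    · rw [hij, ← Pi.single_mul, one_mul]
    · ext k
      by_cases hk : k = i <;> simp [Pi.single_apply, hk, hij]
  rw [specProj, specProj, multiplier_eq hY, multiplier_eq hY, ← map_mul, ← map_mul, hsingle]
  split_ifs <;> simp

theorem multiplier_eq_sum (hY : IsUnit Y) (c : Fin N → ℂ) :
    multiplier Y c = ∑ j, c j • specProj Y j := by
  simp only [specProj, multiplier_eq hY, ← map_smul, ← map_sum]
  congr 2
  ext j
  simp [Pi.single_apply]

theorem sum_specProj (hY : IsUnit Y) : ∑ j, specProj Y j = 1 := by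
  simpa [multiplier_eq hY] using (multiplier_eq_sum hY 1).symm

/-- The eigenvalue of the heat kernel matrix at time `t` and distance `s = |e^{tS}x - ξ|` which
belongs to the eigenvalues `a` and `b` of `A` and `B`. -/
def heatCoeff (d : ℕ) (a b : ℂ) (t s : ℝ) : ℂ :=
  (4 * Real.pi * t * a) ^ (-(d : ℂ) / 2) * Complex.exp (-(t * b) - (s ^ 2 : ℝ) * (4 * t * a)⁻¹)

theorem SpectralData.heatKernel_mulVec {a b : Fin N → ℂ} (h : SpectralData A B Y a b) {d : ℕ}
    (S : Matrix (Fin d) (Fin d) ℝ) (x ξ : Rd d) {t : ℝ} (ht : 0 < t) (v : CN N) :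
    WithLp.toLp 2 ((heatKernel A B S x ξ t).mulVec v.ofLp) =
      multiplier Y (fun j => heatCoeff d (a j) (b j) t ‖rot S t x - ξ‖) v := by
  have hne (j : Fin N) : ((4 * t : ℂ) • a) j ≠ 0 :=
    mul_ne_zero (mul_ne_zero (by norm_num) (Complex.ofReal_ne_zero.2 ht.ne')) (h.ne_zero j)
  obtain ⟨hY, rfl, rfl, -⟩ := h
  rw [multiplier_eq hY, heatKernel, ← map_smul, ← map_smul, ← map_smul, inv_conjDiag hY hne,
    matCPow_conjDiag, ← map_smul, ← map_neg, ← map_sub, exp_conjDiag, ← map_mul]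
  rfl

end Matrices

section Rotation

variable {d : ℕ}

/-- The rotation `e^{tS}` as a continuous linear map. -/
def rotCLM (S : Matrix (Fin d) (Fin d) ℝ) (t : ℝ) : Rd d →L[ℝ] Rd d :=
  Matrix.toEuclideanCLM (n := Fin d) (𝕜 := ℝ) (NormedSpace.exp (t • S))

theorem rot_eq (S : Matrix (Fin d) (Fin d) ℝ) (t : ℝ) (x : Rd d) : rot S t x = rotCLM S t x := rfl

open scoped Matrix.Norms.L2Operator in
theorem continuous_rotCLM (S : Matrix (Fin d) (Fin d) ℝ) : Continuous (rotCLM S) := by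
  let _ : NormedAlgebra ℚ (Matrix (Fin d) (Fin d) ℝ) := NormedAlgebra.restrictScalars ℚ ℝ _
  have hexp : Continuous fun t : ℝ => NormedSpace.exp (t • S) :=
    NormedSpace.exp_continuous.comp (by fun_prop)
  have hlin : Continuous (Matrix.toEuclideanCLM (n := Fin d) (𝕜 := ℝ)) :=
    LinearMap.continuous_of_finiteDimensional
      (Matrix.toEuclideanCLM (n := Fin d) (𝕜 := ℝ)).toAlgEquiv.toLinearMap
  exact hlin.comp hexp

theorem continuous_rot (S : Matrix (Fin d) (Fin d) ℝ) :
    Continuous fun p : ℝ × Rd d => rot S p.1 p.2 :=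
  ((continuous_rotCLM S).comp continuous_fst).clm_apply continuous_snd

theorem rot_zero (S : Matrix (Fin d) (Fin d) ℝ) (x : Rd d) : rot S 0 x = x := by
  simp [rot_eq, rotCLM]

theorem rot_add (S : Matrix (Fin d) (Fin d) ℝ) (s t : ℝ) (x : Rd d) :
    rot S (s + t) x = rot S s (rot S t x) := by
  simp only [rot_eq, rotCLM]
  rw [add_smul, Matrix.exp_add_of_commute _ _ ((Commute.refl S).smul_left s |>.smul_right t),
    map_mul]
  rfl

theorem exp_smul_mem_unitary {S : Matrix (Fin d) (Fin d) ℝ} (hS : S.transpose = -S) (t : ℝ) :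
    NormedSpace.exp (t • S) ∈ unitary (Matrix (Fin d) (Fin d) ℝ) := by
  have hstar : star (NormedSpace.exp (t • S)) = (NormedSpace.exp (t • S))⁻¹ := by
    rw [Matrix.star_eq_conjTranspose, Matrix.conjTranspose_eq_transpose_of_trivial,
      ← Matrix.exp_transpose, Matrix.transpose_smul, hS, smul_neg, Matrix.exp_neg]
  have hdet := (Matrix.isUnit_iff_isUnit_det _).1 (Matrix.isUnit_exp (t • S))
  rw [Unitary.mem_iff, hstar]
  exact ⟨Matrix.nonsing_inv_mul _ hdet, Matrix.mul_nonsing_inv _ hdet⟩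

theorem norm_rot {S : Matrix (Fin d) (Fin d) ℝ} (hS : S.transpose = -S) (t : ℝ) (x : Rd d) :
    ‖rot S t x‖ = ‖x‖ :=
  ContinuousLinearMap.norm_map_of_mem_unitary (u := rotCLM S t)
    (Unitary.map_mem _ (exp_smul_mem_unitary hS t)) x

/-- The rotation `e^{tS}` as a linear isometry. -/
def rotIso {S : Matrix (Fin d) (Fin d) ℝ} (hS : S.transpose = -S) (t : ℝ) : Rd d ≃ₗᵢ[ℝ] Rd d where
  toFun := rot S t
  invFun := rot S (-t)
  map_add' := (rotCLM S t).map_add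
  map_smul' := (rotCLM S t).map_smul
  left_inv x := by rw [← rot_add, neg_add_cancel, rot_zero]
  right_inv x := by rw [← rot_add, add_neg_cancel, rot_zero]
  norm_map' := norm_rot hS t

end Rotation

/-! ### The space `C_rub` -/

section Crub

open BoundedContinuousFunction

variable {d : ℕ} {E : Type*} [NormedAddCommGroup E]

/-- The action `f ↦ f(e^{tS}x - c)` of the rigid motion with parameters `p = (t, c)`. -/
def motion (S : Matrix (Fin d) (Fin d) ℝ) (p : ℝ × Rd d) (f : Rd d →ᵇ E) : Rd d →ᵇ E :=
  f.compContinuous ⟨fun x => rot S p.1 x - p.2, (rotCLM S p.1).continuous.sub continuous_const⟩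

theorem motion_apply (S : Matrix (Fin d) (Fin d) ℝ) (p : ℝ × Rd d) (f : Rd d →ᵇ E) (x : Rd d) :
    motion S p f x = f (rot S p.1 x - p.2) := rfl

theorem motion_sub (S : Matrix (Fin d) (Fin d) ℝ) (p : ℝ × Rd d) (f g : Rd d →ᵇ E) :
    motion S p (f - g) = motion S p f - motion S p g := rfl

theorem norm_motion_le (S : Matrix (Fin d) (Fin d) ℝ) (p : ℝ × Rd d) (f : Rd d →ᵇ E) :
    ‖motion S p f‖ ≤ ‖f‖ :=
  (BoundedContinuousFunction.norm_le (norm_nonneg _)).2 fun _ => f.norm_coe_le_norm _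

theorem motion_motion (S : Matrix (Fin d) (Fin d) ℝ) (p q : ℝ × Rd d) (f : Rd d →ᵇ E) :
    motion S p (motion S q f) = motion S (q.1 + p.1, rot S q.1 p.2 + q.2) f := by
  ext x
  simp only [motion_apply, rot_add]
  simp only [rot_eq, map_sub, sub_sub]

theorem continuous_motion_of_tendsto {S : Matrix (Fin d) (Fin d) ℝ} {f : Rd d →ᵇ E}
    (hf : Tendsto (fun p => motion S p f) (𝓝 0) (𝓝 f)) : Continuous fun p => motion S p f := by
  rw [continuous_iff_continuousAt]
  rintro ⟨t₀, c₀⟩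
  let q (p : ℝ × Rd d) : ℝ × Rd d := (p.1 - t₀, p.2 - rot S (p.1 - t₀) c₀)
  have hq : Tendsto q (𝓝 (t₀, c₀)) (𝓝 0) := by
    have hcont : Continuous q := (continuous_fst.sub continuous_const).prodMk
      (continuous_snd.sub ((continuous_rot S).comp
        ((continuous_fst.sub continuous_const).prodMk continuous_const)))
    exact hcont.tendsto' _ _ (by simp [q, rot_zero])
  have hmotion (p : ℝ × Rd d) : motion S p f = motion S (t₀, c₀) (motion S (q p) f) := by
    simp [motion_motion, q]
  refine tendsto_iff_norm_sub_tendsto_zero.2 <| squeeze_zero (fun _ => norm_nonneg _) (fun p => ?_)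
    (tendsto_iff_norm_sub_tendsto_zero.1 (hf.comp hq))
  rw [hmotion p, ← motion_sub]
  exact norm_motion_le S _ _

variable [NormedSpace ℂ E]

/-- The space `C_rub` as a closed subspace of the bounded continuous functions: the functions on
which rigid motions act strongly continuously (see `MemCrub.exists_crub` and `memCrub_coe`). -/
def Crub (S : Matrix (Fin d) (Fin d) ℝ) (E : Type*) [NormedAddCommGroup E] [NormedSpace ℂ E] :
    Submodule ℂ (Rd d →ᵇ E) where
  carrier := {f | Continuous fun p => motion S p f}
  add_mem' hf hg := Continuous.add hf hg
  zero_mem' := (continuous_const : Continuous fun _ : ℝ × Rd d => (0 : Rd d →ᵇ E))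
  smul_mem' c _ hf := Continuous.const_smul hf c

variable {S : Matrix (Fin d) (Fin d) ℝ}

theorem mem_Crub_iff {f : Rd d →ᵇ E} : f ∈ Crub S E ↔ Continuous fun p => motion S p f := Iff.rfl

theorem isClosed_Crub : IsClosed (Crub S E : Set (Rd d →ᵇ E)) := by
  refine isClosed_of_closure_subset fun f hf =>
    continuous_of_uniform_approx_of_continuous fun u hu => ?_
  obtain ⟨ε, hε, hεu⟩ := Metric.mem_uniformity_dist.1 hu
  obtain ⟨g, hg, hfg⟩ := Metric.mem_closure_iff.1 hf ε hε
  refine ⟨fun p => motion S p g, hg, fun p => hεu (lt_of_le_of_lt ?_ hfg)⟩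
  rw [dist_eq_norm, dist_eq_norm, ← motion_sub]
  exact norm_motion_le S p (f - g)

instance [CompleteSpace E] : CompleteSpace (Crub S E) := isClosed_Crub.completeSpace_coe

/-- Rigid motions as operators on `C_rub`. -/
def motionCLM (S : Matrix (Fin d) (Fin d) ℝ) (p : ℝ × Rd d) : Crub S E →L[ℂ] Crub S E :=
  LinearMap.mkContinuous
    { toFun := fun f => ⟨motion S p f.1, by
        simp only [mem_Crub_iff, motion_motion]
        exact (mem_Crub_iff.1 f.2).comp ((continuous_const.add continuous_fst).prodMk
          (((rotCLM S p.1).continuous.comp continuous_snd).add continuous_const))⟩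
      map_add' := fun _ _ => rfl
      map_smul' := fun _ _ => rfl } 1
    fun f => by rw [one_mul]; exact norm_motion_le S p f.1

theorem norm_motionCLM_le (p : ℝ × Rd d) (f : Crub S E) : ‖motionCLM S p f‖ ≤ ‖f‖ :=
  norm_motion_le S p f.1

theorem continuous_motionCLM (f : Crub S E) : Continuous fun p => motionCLM S p f :=
  Continuous.subtype_mk (mem_Crub_iff.1 f.2) _

/-- Pointwise application of an operator on the space of values. -/
def postComp (S : Matrix (Fin d) (Fin d) ℝ) (P : E →L[ℂ] E) : Crub S E →L[ℂ] Crub S E :=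
  ((P.compLeftContinuousBounded (Rd d)).comp (Crub S E).subtypeL).codRestrict (Crub S E)
    fun f => (P.compLeftContinuousBounded (Rd d)).continuous.comp (mem_Crub_iff.1 f.2)

/-- Evaluation at a point of `ℝ^d`. -/
def evalCLM (S : Matrix (Fin d) (Fin d) ℝ) (E : Type*) [NormedAddCommGroup E] [NormedSpace ℂ E]
    (x : Rd d) : Crub S E →L[ℂ] E :=
  (BoundedContinuousFunction.evalCLM ℂ x).comp (Crub S E).subtypeL

theorem evalCLM_apply (f : Crub S E) (x : Rd d) : evalCLM S E x f = f.1 x := rfl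

variable {N : ℕ}

theorem MemCrub.exists_crub {v : Rd d → CN N} (hv : MemCrub S v) :
    ∃ f : Crub S (CN N), ∀ x, f.1 x = v x := by
  obtain ⟨⟨⟨hc, M, hM⟩, hu⟩, hr⟩ := hv
  refine ⟨⟨.ofNormedAddCommGroup v hc M hM, continuous_motion_of_tendsto ?_⟩, fun x => rfl⟩
  rw [BoundedContinuousFunction.tendsto_iff_tendstoUniformly, Metric.tendstoUniformly_iff]
  intro ε hε
  obtain ⟨δ, hδ, hδu⟩ := Metric.uniformContinuous_iff.1 hu (ε / 2) (half_pos hε)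
  have htime : Tendsto (fun p : ℝ × Rd d => -p.1) (𝓝 0) (𝓝 0) :=
    continuous_fst.neg.tendsto' _ _ neg_zero
  have hspace : Tendsto (fun p : ℝ × Rd d => p.2) (𝓝 0) (𝓝 0) := continuous_snd.tendsto 0
  filter_upwards [htime.eventually (Metric.tendstoUniformly_iff.1 hr (ε / 2) (half_pos hε)),
    hspace.eventually (Metric.ball_mem_nhds 0 hδ)] with p hrot hshift x
  have hrot : dist (v x) (v (rot S p.1 x)) < ε / 2 := by simpa using hrot x
  have hshift : dist (v (rot S p.1 x)) (v (rot S p.1 x - p.2)) < ε / 2 :=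
    hδu (by simpa [dist_eq_norm] using hshift)
  exact (dist_triangle _ _ _).trans_lt ((add_lt_add hrot hshift).trans_eq (add_halves ε))

theorem eventually_dist_motion_lt (f : Crub S E) {ε : ℝ} (hε : 0 < ε) :
    ∀ᶠ p in 𝓝 (0 : ℝ × Rd d), ∀ x, dist (f.1 x) (f.1 (rot S p.1 x - p.2)) < ε := by
  have htendsto := (mem_Crub_iff.1 f.2).tendsto 0
  rw [BoundedContinuousFunction.tendsto_iff_tendstoUniformly] at htendsto
  filter_upwards [Metric.tendstoUniformly_iff.1 htendsto ε hε] with p hp x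
  simpa [motion_apply, rot_zero] using hp x

theorem memCrub_coe (f : Crub S (CN N)) : MemCrub S fun x => f.1 x := by
  refine ⟨⟨⟨f.1.continuous, ‖f.1‖, f.1.norm_coe_le_norm⟩,
    Metric.uniformContinuous_iff.2 fun ε hε => ?_⟩, Metric.tendstoUniformly_iff.2 fun ε hε => ?_⟩
  · obtain ⟨δ, hδ, hdist⟩ := Metric.eventually_nhds_iff.1 (eventually_dist_motion_lt f hε)
    refine ⟨δ, hδ, fun x y hxy => ?_⟩
    have hshift : dist ((0 : ℝ), x - y) 0 < δ := by simpa [Prod.dist_eq, hδ, dist_eq_norm] using hxy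
    simpa [rot_zero] using hdist hshift x
  · have htime : Tendsto (fun t : ℝ => (-t, (0 : Rd d))) (𝓝 0) (𝓝 0) :=
      (continuous_neg.prodMk continuous_const).tendsto' _ _ (by simp)
    filter_upwards [htime.eventually (eventually_dist_motion_lt f hε)] with t ht x
    simpa using ht x

end Crub

/-! ### The complex heat kernel -/

section Gauss

variable {V : Type*} [NormedAddCommGroup V] [InnerProductSpace ℝ V] {α : ℂ}

/-- The complex heat kernel `(4πα)^{-d/2} exp(-|y|²/(4α))` on a space of dimension `d`, with the
principal branch of the power. -/
def gauss (α : ℂ) (y : V) : ℂ :=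
  (4 * Real.pi * α) ^ (-(Module.finrank ℝ V : ℂ) / 2) *
    Complex.exp (-(4 * α)⁻¹ * (‖y‖ : ℂ) ^ 2)

@[fun_prop]
theorem continuous_gauss (α : ℂ) : Continuous (gauss α : V → ℂ) := by
  unfold gauss
  fun_prop

theorem re_inv_four_mul (α : ℂ) : ((4 * α)⁻¹).re = α.re / (4 * ‖α‖ ^ 2) := by
  rw [mul_inv, ← Complex.ofReal_ofNat, ← Complex.ofReal_inv, Complex.re_ofReal_mul, Complex.inv_re,
    Complex.sq_norm]
  ring

theorem norm_gauss (α : ℂ) (y : V) : ‖gauss α y‖ =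
    (4 * Real.pi * ‖α‖) ^ (-(Module.finrank ℝ V : ℝ) / 2) *
      Real.exp (-(α.re / (4 * ‖α‖ ^ 2)) * ‖y‖ ^ 2) := by
  have hexponent : -(Module.finrank ℝ V : ℂ) / 2 = ((-(Module.finrank ℝ V : ℝ) / 2 : ℝ) : ℂ) := by
    push_cast
    ring
  rw [gauss, norm_mul, Complex.norm_exp, ← Complex.ofReal_pow, Complex.re_mul_ofReal,
    Complex.neg_re, re_inv_four_mul, hexponent, Complex.norm_cpow_real]
  simp [abs_of_pos Real.pi_pos]

theorem norm_gauss_le {am K : ℝ} (ham : 0 < am) (hα : am ≤ ‖α‖) (hK : 0 < K)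
    (hαK : ‖α‖ ^ 2 ≤ K * α.re) (y : V) : ‖gauss α y‖ ≤
    (4 * Real.pi * am) ^ (-(Module.finrank ℝ V : ℝ) / 2) *
      Real.exp (-‖y‖ ^ 2 / (4 * K)) := by
  have : 0 < ‖α‖ := ham.trans_le hα
  have hrate : 1 / (4 * K) ≤ α.re / (4 * ‖α‖ ^ 2) := by
    rw [div_le_div_iff₀ (by positivity) (by positivity)]
    linarith
  have hexp : -(α.re / (4 * ‖α‖ ^ 2)) * ‖y‖ ^ 2 ≤ -‖y‖ ^ 2 / (4 * K) := by
    calc _ ≤ -(1 / (4 * K)) * ‖y‖ ^ 2 := by gcongr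
      _ = _ := by ring
  have hexponent : -(Module.finrank ℝ V : ℝ) / 2 ≤ 0 := by
    rw [neg_div]
    exact neg_nonpos.2 (by positivity)
  have hprefactor := Real.rpow_le_rpow_of_nonpos (by positivity)
    (by gcongr : 4 * Real.pi * am ≤ 4 * Real.pi * ‖α‖) hexponent
  rw [norm_gauss]
  exact mul_le_mul hprefactor (Real.exp_le_exp.2 hexp) (Real.exp_pos _).le (by positivity)

theorem norm_pos_of_re_pos (hα : 0 < α.re) : 0 < ‖α‖ :=
  hα.trans_le ((le_abs_self _).trans (Complex.abs_re_le_norm α))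

theorem norm_gauss_le_of_re_pos (hα : 0 < α.re) (y : V) : ‖gauss α y‖ ≤
    (4 * Real.pi * ‖α‖) ^ (-(Module.finrank ℝ V : ℝ) / 2) *
      Real.exp (-‖y‖ ^ 2 / (4 * (‖α‖ ^ 2 / α.re))) := by
  have hnorm := norm_pos_of_re_pos hα
  exact norm_gauss_le hnorm le_rfl (by positivity) (div_mul_cancel₀ _ hα.ne').ge y

variable [FiniteDimensional ℝ V] [MeasurableSpace V] [BorelSpace V]

theorem integrable_norm_pow_mul_gauss (hα : 0 < α.re) (n : ℕ) :
    Integrable fun y : V => ‖y‖ ^ n * ‖gauss α y‖ := by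
  have := norm_pos_of_re_pos hα
  refine ((integrable_norm_pow_mul_exp (K := ‖α‖ ^ 2 / α.re) n (by positivity)).const_mul
    ((4 * Real.pi * ‖α‖) ^ (-(Module.finrank ℝ V : ℝ) / 2))).mono' (by fun_prop)
    (Eventually.of_forall fun y => ?_)
  rw [Real.norm_of_nonneg (by positivity), mul_left_comm]
  gcongr
  exact norm_gauss_le_of_re_pos hα y

theorem integrable_gauss (hα : 0 < α.re) : Integrable (gauss α : V → ℂ) := by
  refine (integrable_norm_pow_mul_gauss hα 0).mono' (by fun_prop)
    (Eventually.of_forall fun y => ?_)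
  rw [pow_zero, one_mul]

theorem integral_gauss (hα : 0 < α.re) : ∫ y : V, gauss α y = 1 := by
  have hα0 : α ≠ 0 := norm_pos_iff.1 (norm_pos_of_re_pos hα)
  have hre : 0 < ((4 * α)⁻¹).re := by
    have := norm_pos_of_re_pos hα
    rw [re_inv_four_mul]
    positivity
  have hπα : (4 * Real.pi * α : ℂ) ≠ 0 :=
    mul_ne_zero (mul_ne_zero (by norm_num) (Complex.ofReal_ne_zero.2 Real.pi_ne_zero)) hα0
  unfold gauss
  rw [integral_const_mul, GaussianFourier.integral_cexp_neg_mul_sq_norm hre,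
    div_inv_eq_mul, ← mul_assoc, mul_comm (Real.pi : ℂ), ← Complex.cpow_add _ _ hπα,
    neg_div, neg_add_cancel, Complex.cpow_zero]

end Gauss

section GaussConvolution

variable {V : Type*} [NormedAddCommGroup V] [InnerProductSpace ℝ V] {α : ℂ}

-- `(y, κ u - μ y) ↦ (u, κ y - μ u)` is an isometry of `V × V` because `κ² = 1 + μ²`.
theorem gauss_mul_gauss (α : ℂ) {κ μ : ℝ} (h : κ ^ 2 = 1 + μ ^ 2) (y u : V) :
    gauss α y * gauss α (κ • u - μ • y) = gauss α u * gauss α (κ • y - μ • u) := by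
  have hisometry : ‖y‖ ^ 2 + ‖κ • u - μ • y‖ ^ 2 = ‖u‖ ^ 2 + ‖κ • y - μ • u‖ ^ 2 := by
    simp only [norm_sub_sq_real, norm_smul, real_inner_smul_left, real_inner_smul_right, mul_pow,
      Real.norm_eq_abs, sq_abs, h, real_inner_comm y u]
    ring
  have : (‖y‖ : ℂ) ^ 2 + (‖κ • u - μ • y‖ : ℂ) ^ 2 =
      (‖u‖ : ℂ) ^ 2 + (‖κ • y - μ • u‖ : ℂ) ^ 2 := mod_cast hisometry
  unfold gauss
  rw [mul_mul_mul_comm, ← Complex.exp_add, ← mul_add, this, mul_add, Complex.exp_add,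
    mul_mul_mul_comm]

variable [FiniteDimensional ℝ V] [MeasurableSpace V] [BorelSpace V]

theorem integral_comp_smul_sub {F : Type*} [NormedAddCommGroup F] [NormedSpace ℝ F] (f : V → F)
    {κ : ℝ} (hκ : 0 < κ) (v : V) :
    ∫ u, f (κ • u - v) = (κ ^ Module.finrank ℝ V)⁻¹ • ∫ z, f z := by
  rw [Measure.integral_comp_smul volume (fun z => f (z - v)) κ, abs_of_pos (by positivity),
    integral_sub_right_eq_self]

variable {E : Type*} [NormedAddCommGroup E] [NormedSpace ℂ E]

theorem integrable_gauss_mul_gauss_smul (hα : 0 < α.re) {κ : ℝ} (hκ : 0 < κ) (μ : ℝ) {f : V → E}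
    (hf : Continuous f) {M : ℝ} (hM : ∀ x, ‖f x‖ ≤ M) :
    Integrable (fun p : V × V => (gauss α p.2 * gauss α (κ • p.1 - μ • p.2)) • f p.2)
      (volume.prod volume) := by
  have hcont : Continuous fun p : V × V =>
      (gauss α p.2 * gauss α (κ • p.1 - μ • p.2)) • f p.2 := by fun_prop
  have hnorm (u : V) : ∫ y, ‖(gauss α u * gauss α (κ • y - μ • u)) • f u‖ =
      ((κ ^ Module.finrank ℝ V)⁻¹ * ∫ z : V, ‖gauss α z‖) * (‖gauss α u‖ * ‖f u‖) := by
    rw [← smul_eq_mul (_⁻¹), ← integral_comp_smul_sub (fun z : V => ‖gauss α z‖) hκ (μ • u),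
      ← integral_mul_const]
    refine integral_congr_ae (Eventually.of_forall fun y => ?_)
    simp only [norm_smul, norm_mul]
    ring
  rw [integrable_prod_iff' hcont.aestronglyMeasurable]
  refine ⟨Eventually.of_forall fun u =>
    (((integrable_gauss hα).comp_sub_right (μ • u)).comp_smul hκ.ne').const_mul
      (gauss α u) |>.smul_const (f u), ?_⟩
  simp only [hnorm]
  refine .const_mul (((integrable_gauss hα).norm.mul_const M).mono'
    (by fun_prop : Continuous fun u : V => ‖gauss α u‖ * ‖f u‖).aestronglyMeasurable
    (Eventually.of_forall fun u => ?_)) _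
  rw [Real.norm_of_nonneg (by positivity)]
  gcongr
  exact hM u

variable [NormedSpace ℝ E]

theorem integral_gauss_smul_comp_add [SMulCommClass ℝ ℂ E] (h : V → E) {s t : ℝ} (hs : 0 < s)
    (ht : 0 < t) (y : V) :
    gauss α y • ∫ z, gauss α z • h (√s • y + √t • z) =
      (√(s + t) / √t) ^ Module.finrank ℝ V • ∫ u,
        (gauss α u * gauss α ((√(s + t) / √t) • y - (√s / √t) • u)) • h (√(s + t) • u) := by
  have hsqrt : √t ≠ 0 := (Real.sqrt_pos.2 ht).ne'
  have hκ : 0 < √(s + t) / √t := by positivity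
  have hκμ : (√(s + t) / √t) ^ 2 = 1 + (√s / √t) ^ 2 := by
    rw [div_pow, div_pow, Real.sq_sqrt hs.le, Real.sq_sqrt ht.le, Real.sq_sqrt (by positivity)]
    field_simp
    ring
  have hpoint (u : V) :
      √s • y + √t • ((√(s + t) / √t) • u - (√s / √t) • y) = √(s + t) • u := by
    rw [smul_sub, smul_smul, smul_smul, mul_div_cancel₀ _ hsqrt, mul_div_cancel₀ _ hsqrt,
      add_sub_cancel]
  have hsubst := integral_comp_smul_sub (fun z => gauss α z • h (√s • y + √t • z)) hκ
    ((√s / √t) • y)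
  rw [eq_inv_smul_iff₀ (by positivity)] at hsubst
  rw [← hsubst, smul_comm, ← integral_smul]
  congr with u
  rw [hpoint, smul_smul, gauss_mul_gauss α hκμ]

variable [IsScalarTower ℝ ℂ E] [CompleteSpace E]

theorem integral_gauss_integral_gauss (hα : 0 < α.re) {s t : ℝ} (hs : 0 < s) (ht : 0 < t)
    {h : V → E} (hc : Continuous h) {M : ℝ} (hM : ∀ x, ‖h x‖ ≤ M) :
    ∫ y, gauss α y • ∫ z, gauss α z • h (√s • y + √t • z) =
      ∫ u, gauss α u • h (√(s + t) • u) := by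
  have hκ : 0 < √(s + t) / √t := by positivity
  simp only [integral_gauss_smul_comp_add h hs ht]
  rw [integral_smul, integral_integral_swap (integrable_gauss_mul_gauss_smul hα hκ _
    (hc.comp (continuous_const_smul _)) fun _ => hM _), ← integral_smul]
  congr with u
  rw [integral_smul_const, integral_const_mul, integral_comp_smul_sub (gauss α) hκ,
    integral_gauss hα, mul_smul_comm, mul_one, smul_assoc, smul_inv_smul₀ (by positivity)]

end GaussConvolution

section GaussDeriv

theorem exp_neg_norm_sq_le_of_norm_sub_le_one {V : Type*} [SeminormedAddCommGroup V]
    {K : ℝ} (hK : 0 < K) {y w : V} (h : ‖y - w‖ ≤ 1) : Real.exp (-‖y‖ ^ 2 / (4 * K)) ≤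
      Real.exp (1 / (2 * K)) * Real.exp (-‖w‖ ^ 2 / (4 * (2 * K))) := by
  have hw : ‖w‖ ≤ ‖y‖ + 1 := by
    have := norm_le_norm_add_norm_sub y w
    linarith
  have hsq : ‖w‖ ^ 2 ≤ 2 * ‖y‖ ^ 2 + 2 := by
    nlinarith [sq_nonneg (‖y‖ - 1), norm_nonneg w]
  rw [← Real.exp_add, Real.exp_le_exp, div_add_div _ _ (by positivity) (by positivity),
    div_le_div_iff₀ (by positivity) (by positivity)]
  have : 0 < K ^ 2 := by positivity
  nlinarith

variable {V : Type*} [NormedAddCommGroup V] [InnerProductSpace ℝ V] {α : ℂ}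

/-- The Fréchet derivative `e ↦ -(2α)⁻¹ ⟪y, e⟫ gauss α y` of the complex heat kernel. -/
def dgauss (α : ℂ) (y : V) : V →L[ℝ] ℂ :=
  (-(2 * α)⁻¹ * gauss α y) • Complex.ofRealCLM.comp (innerSL ℝ y)

theorem dgauss_apply (α : ℂ) (y e : V) :
    dgauss α y e = -(2 * α)⁻¹ * gauss α y * (inner ℝ y e : ℝ) := rfl

@[fun_prop]
theorem continuous_dgauss (α : ℂ) : Continuous (dgauss α : V → V →L[ℝ] ℂ) := by
  unfold dgauss
  fun_prop

theorem hasFDerivAt_gauss (α : ℂ) (y : V) : HasFDerivAt (gauss α) (dgauss α y) y := by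
  have hsq : HasFDerivAt (fun y : V => (‖y‖ : ℂ) ^ 2)
      (Complex.ofRealCLM.comp (2 • innerSL ℝ y)) y := by
    have := Complex.ofRealCLM.hasFDerivAt.comp y (hasStrictFDerivAt_norm_sq y).hasFDerivAt
    refine this.congr_of_eventuallyEq (Eventually.of_forall fun z => ?_)
    simp
  refine (((hsq.const_mul (-(4 * α)⁻¹)).cexp).const_mul
    ((4 * Real.pi * α) ^ (-(Module.finrank ℝ V : ℂ) / 2))).congr_fderiv ?_
  ext e
  simp [dgauss_apply, gauss]
  ring

theorem norm_dgauss_le (α : ℂ) (y : V) :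
    ‖dgauss α y‖ ≤ (2 * ‖α‖)⁻¹ * (‖y‖ * ‖gauss α y‖) := by
  refine ContinuousLinearMap.opNorm_le_bound _ (by positivity) fun e => ?_
  rw [dgauss_apply, norm_mul, norm_mul, norm_neg, norm_inv, norm_mul, Complex.norm_ofNat,
    Complex.norm_real]
  calc _ ≤ (2 * ‖α‖)⁻¹ * ‖gauss α y‖ * (‖y‖ * ‖e‖) := by
        gcongr
        exact norm_inner_le_norm y e
    _ = _ := by ring

variable [FiniteDimensional ℝ V] [MeasurableSpace V] [BorelSpace V]

theorem integrable_dgauss (hα : 0 < α.re) : Integrable (dgauss α : V → V →L[ℝ] ℂ) := by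
  refine ((integrable_norm_pow_mul_gauss hα 1).const_mul (2 * ‖α‖)⁻¹).mono'
    (continuous_dgauss α).aestronglyMeasurable (Eventually.of_forall fun y => ?_)
  rw [pow_one]
  exact norm_dgauss_le α y

theorem exists_integrable_forall_norm_dgauss_le (hα : 0 < α.re) : ∃ g : V → ℝ, Integrable g ∧
    ∀ y w, ‖y - w‖ ≤ 1 → ‖dgauss α y‖ ≤ g w := by
  have := norm_pos_of_re_pos hα
  set K := ‖α‖ ^ 2 / α.re
  have hK : 0 < K := by positivity
  refine ⟨fun w => (2 * ‖α‖)⁻¹ * ((4 * Real.pi * ‖α‖) ^ (-(Module.finrank ℝ V : ℝ) / 2)) *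
    Real.exp (1 / (2 * K)) * (‖w‖ ^ 1 * Real.exp (-‖w‖ ^ 2 / (4 * (2 * K))) +
      ‖w‖ ^ 0 * Real.exp (-‖w‖ ^ 2 / (4 * (2 * K)))),
    .const_mul (.add (integrable_norm_pow_mul_exp 1 (by positivity))
      (integrable_norm_pow_mul_exp 0 (by positivity))) _, fun y w h => ?_⟩
  have hy : ‖y‖ ≤ ‖w‖ + 1 := by
    have := norm_le_norm_add_norm_sub' y w
    linarith
  calc _ ≤ (2 * ‖α‖)⁻¹ * (‖y‖ * ‖gauss α y‖) := norm_dgauss_le α y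
    _ ≤ (2 * ‖α‖)⁻¹ * ((‖w‖ + 1) *
        ((4 * Real.pi * ‖α‖) ^ (-(Module.finrank ℝ V : ℝ) / 2) *
          (Real.exp (1 / (2 * K)) * Real.exp (-‖w‖ ^ 2 / (4 * (2 * K)))))) := by
      gcongr
      refine (norm_gauss_le_of_re_pos hα y).trans ?_
      gcongr
      exact exp_neg_norm_sq_le_of_norm_sub_le_one hK h
    _ = _ := by ring

end GaussDeriv

section KernelIntegrals

variable {X E : Type*} [TopologicalSpace X] [MeasurableSpace X] [OpensMeasurableSpace X]
  [SecondCountableTopology X] {μ : Measure X} [NormedAddCommGroup E] [NormedSpace ℂ E]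

theorem integrable_smul_of_continuous_bounded {k : X → ℂ} (hk : Integrable k μ) {F : X → E}
    (hF : Continuous F) {C : ℝ} (hC : ∀ y, ‖F y‖ ≤ C) : Integrable (fun y => k y • F y) μ :=
  hk.smul_bdd C hF.aestronglyMeasurable (Eventually.of_forall hC)

theorem continuous_integral_smul [NormedSpace ℝ E] {k : ℝ → X → ℂ}
    (hk : Continuous fun p : ℝ × X => k p.1 p.2) {b : X → ℝ} (hb : Integrable b μ)
    (hkb : ∀ t y, ‖k t y‖ ≤ b y) {F : ℝ → X → E} (hF : Continuous fun p : ℝ × X => F p.1 p.2)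
    {C : ℝ} (hC : ∀ t y, ‖F t y‖ ≤ C) : Continuous fun t => ∫ y, k t y • F t y ∂μ := by
  have hcont : Continuous fun p : ℝ × X => k p.1 p.2 • F p.1 p.2 := hk.smul hF
  refine continuous_of_dominated (bound := fun y => b y * C)
    (fun t => (hcont.comp (Continuous.prodMk_right t)).aestronglyMeasurable)
    (fun t => Eventually.of_forall fun y => ?_) (hb.mul_const _)
    (Eventually.of_forall fun y => hcont.comp (Continuous.prodMk_left y))
  rw [norm_smul]
  exact mul_le_mul (hkb t y) (hC t y) (norm_nonneg _) ((norm_nonneg _).trans (hkb t y))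

end KernelIntegrals

section ConvolutionDeriv

section SmulRight

variable {V E : Type*} [NormedAddCommGroup V] [NormedSpace ℝ V] [NormedAddCommGroup E]
  [NormedSpace ℝ E] [NormedSpace ℂ E] [IsScalarTower ℝ ℂ E]

theorem norm_smulRight_le (φ : V →L[ℝ] ℂ) (v : E) : ‖φ.smulRight v‖ ≤ ‖φ‖ * ‖v‖ := by
  refine ContinuousLinearMap.opNorm_le_bound _ (by positivity) fun e => ?_
  rw [ContinuousLinearMap.smulRight_apply, norm_smul, mul_right_comm]
  gcongr
  exact φ.le_opNorm e

theorem continuous_smulRight {X : Type*} [TopologicalSpace X] {φ : X → V →L[ℝ] ℂ} {v : X → E}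
    (hφ : Continuous φ) (hv : Continuous v) : Continuous fun x => (φ x).smulRight (v x) :=
  ((ContinuousLinearMap.lsmul ℝ ℂ).flip.continuous.comp hv).clm_comp hφ

end SmulRight

variable {V : Type*} [NormedAddCommGroup V] [NormedSpace ℝ V] [FiniteDimensional ℝ V]
  [MeasurableSpace V] [BorelSpace V] {μ : Measure V} [μ.IsAddHaarMeasure] {E : Type*}
  [NormedAddCommGroup E] [NormedSpace ℝ E] [NormedSpace ℂ E] [IsScalarTower ℝ ℂ E]

theorem hasFDerivAt_integral_smul_comp_sub {k : V → ℂ} {k' : V → V →L[ℝ] ℂ} (hk : Integrable k μ)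
    (hkk' : ∀ y, HasFDerivAt k (k' y) y) (hk' : Continuous k') {g : V → ℝ} (hg : Integrable g μ)
    (hkg : ∀ y w, ‖y - w‖ ≤ 1 → ‖k' y‖ ≤ g w) {h : V → E} (hc : Continuous h) {M : ℝ}
    (hM : ∀ x, ‖h x‖ ≤ M) (z : V) :
    HasFDerivAt (fun z => ∫ y, k y • h (z - y) ∂μ) (∫ y, (k' y).smulRight (h (z - y)) ∂μ) z := by
  have hkc : Continuous k := continuous_iff_continuousAt.2 fun y => (hkk' y).continuousAt
  have hderiv := hasFDerivAt_integral_of_dominated_of_fderiv_le (μ := μ)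
    (F := fun z y => k (z - y) • h y) (F' := fun z y => (k' (z - y)).smulRight (h y))
    (Metric.ball_mem_nhds z one_pos)
    (Eventually.of_forall fun x =>
      (by fun_prop : Continuous fun y => k (x - y) • h y).aestronglyMeasurable)
    (integrable_smul_of_continuous_bounded (hk.comp_sub_left z) hc hM)
    (continuous_smulRight (by fun_prop : Continuous fun y => k' (z - y)) hc).aestronglyMeasurable
    (Eventually.of_forall fun y x hx => (norm_smulRight_le _ _).trans
      (mul_le_mul (hkg (x - y) (z - y) ?_) (hM y) (norm_nonneg _)
        ((norm_nonneg (k' (z - y))).trans (hkg _ _ (by simp)))))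
    ((hg.comp_sub_left z).mul_const M)
    (Eventually.of_forall fun y x _ => (((hasFDerivAt_comp_sub y).2 (hkk' (x - y))).smul_const _))
  · refine (hderiv.congr_fderiv ?_).congr_of_eventuallyEq (Eventually.of_forall fun x => ?_)
    · rw [← integral_sub_left_eq_self _ μ z]
      simp only [sub_sub_cancel]
    · dsimp only
      rw [← integral_sub_left_eq_self _ μ x]
      simp only [sub_sub_cancel]
  · rw [sub_sub_sub_cancel_right, ← dist_eq_norm]
    exact (Metric.mem_ball.1 hx).le

end ConvolutionDeriv

/-! ### The Ornstein-Uhlenbeck semigroup -/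

section KernelOp

variable {d : ℕ} {S : Matrix (Fin d) (Fin d) ℝ} {E : Type*} [NormedAddCommGroup E]
  [NormedSpace ℂ E]

theorem integrable_smul_motionCLM {k : Rd d → ℂ} (hk : Integrable k) (t : ℝ) (f : Crub S E) :
    Integrable fun y => k y • motionCLM S (t, √t • y) f :=
  integrable_smul_of_continuous_bounded hk
    ((continuous_motionCLM f).comp (by fun_prop)) fun y => norm_motionCLM_le _ f

theorem integrable_smul_apply_rot_sub {k : Rd d → ℂ} (hk : Integrable k) (t : ℝ) (f : Crub S E)
    (x : Rd d) : Integrable fun y => k y • f.1 (rot S t x - √t • y) :=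
  (evalCLM S E x).integrable_comp (integrable_smul_motionCLM hk t f)

variable [NormedSpace ℝ E] [IsScalarTower ℝ ℂ E]

/-- The operator `f ↦ ∫ k(y) f(e^{tS}x - √t y) dy` on `C_rub`. Rescaling the convolution variable
by `√t` makes the heat kernel independent of `t`. -/
def kernelOp (S : Matrix (Fin d) (Fin d) ℝ) {k : Rd d → ℂ} (hk : Integrable k) (t : ℝ) :
    Crub S E →L[ℂ] Crub S E :=
  LinearMap.mkContinuous
    { toFun := fun f => ∫ y, k y • motionCLM S (t, √t • y) f
      map_add' := fun f g => by
        rw [← integral_add (integrable_smul_motionCLM hk t f) (integrable_smul_motionCLM hk t g)]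
        simp only [map_add, smul_add]
      map_smul' := fun c f => by
        rw [RingHom.id_apply, ← integral_smul]
        simp only [map_smul, smul_comm c] }
    (∫ y, ‖k y‖)
    (fun f => by
      rw [← integral_mul_const]
      refine norm_integral_le_of_norm_le (hk.norm.mul_const ‖f‖) (Eventually.of_forall fun y => ?_)
      rw [norm_smul]
      exact mul_le_mul_of_nonneg_left (norm_motionCLM_le _ f) (norm_nonneg _))

theorem kernelOp_eq {k : Rd d → ℂ} (hk : Integrable k) (t : ℝ) (f : Crub S E) :
    kernelOp S hk t f = ∫ y, k y • motionCLM S (t, √t • y) f := rfl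

theorem norm_kernelOp_le {k : Rd d → ℂ} (hk : Integrable k) (t : ℝ) :
    ‖(kernelOp S hk t : Crub S E →L[ℂ] Crub S E)‖ ≤ ∫ y, ‖k y‖ :=
  LinearMap.mkContinuous_norm_le _ (integral_nonneg fun _ => norm_nonneg _) _

theorem continuous_kernelOp {k : ℝ → Rd d → ℂ} (hk : Continuous fun p : ℝ × Rd d => k p.1 p.2)
    (hki : ∀ t, Integrable (k t)) {b : Rd d → ℝ} (hb : Integrable b) (hkb : ∀ t y, ‖k t y‖ ≤ b y)
    (f : Crub S E) : Continuous fun t => kernelOp S (hki t) t f := by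
  simp only [kernelOp_eq]
  exact continuous_integral_smul hk hb hkb
    ((continuous_motionCLM f).comp (by fun_prop : Continuous fun p : ℝ × Rd d => (p.1, √p.1 • p.2)))
    fun t y => norm_motionCLM_le _ f

variable [CompleteSpace E]

theorem kernelOp_apply {k : Rd d → ℂ} (hk : Integrable k) (t : ℝ) (f : Crub S E) (x : Rd d) :
    (kernelOp S hk t f).1 x = ∫ y, k y • f.1 (rot S t x - √t • y) := by
  rw [← evalCLM_apply, kernelOp_eq,
    ← ContinuousLinearMap.integral_comp_comm _ (integrable_smul_motionCLM hk t f)]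
  rfl

theorem kernelOp_postComp {k : Rd d → ℂ} (hk : Integrable k) (t : ℝ) (P : E →L[ℂ] E)
    (f : Crub S E) : kernelOp S hk t (postComp S P f) = postComp S P (kernelOp S hk t f) := by
  rw [kernelOp_eq, kernelOp_eq,
    ← ContinuousLinearMap.integral_comp_comm _ (integrable_smul_motionCLM hk t f)]
  simp only [map_smul]
  rfl

end KernelOp

section HeatOp

theorem integral_gauss_smul_comp_isometry {V E : Type*} [NormedAddCommGroup V]
    [InnerProductSpace ℝ V] [FiniteDimensional ℝ V] [MeasurableSpace V] [BorelSpace V]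
    [NormedAddCommGroup E] [NormedSpace ℝ E] [NormedSpace ℂ E] (α : ℂ) (U : V ≃ₗᵢ[ℝ] V)
    (F : V → E) : ∫ y, gauss α y • F (U y) = ∫ y, gauss α y • F y := by
  rw [← U.measurePreserving.integral_comp U.toHomeomorph.measurableEmbedding
    fun y => gauss α y • F y]
  simp only [gauss, U.norm_map]

variable {d : ℕ} {S : Matrix (Fin d) (Fin d) ℝ} {E : Type*} [NormedAddCommGroup E]
  [NormedSpace ℝ E] [NormedSpace ℂ E] [IsScalarTower ℝ ℂ E] {α : ℂ}

/-- The scalar Ornstein-Uhlenbeck semigroup with diffusion coefficient `α` and potential `β`. -/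
def heatOp (S : Matrix (Fin d) (Fin d) ℝ) (hα : 0 < α.re) (β : ℂ) (t : ℝ) :
    Crub S E →L[ℂ] Crub S E :=
  Complex.exp (-(t * β)) • kernelOp S (integrable_gauss hα) t

variable [CompleteSpace E]

theorem kernelOp_gauss_zero (hα : 0 < α.re) (f : Crub S E) :
    kernelOp S (integrable_gauss hα) 0 f = f := by
  ext x
  simp only [kernelOp_apply, rot_zero, Real.sqrt_zero, zero_smul, sub_zero]
  rw [integral_smul_const, integral_gauss hα, one_smul]

theorem kernelOp_gauss_add (hS : S.transpose = -S) (hα : 0 < α.re) {s t : ℝ} (hs : 0 < s)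
    (ht : 0 < t) (f : Crub S E) : kernelOp S (integrable_gauss hα) (s + t) f =
      kernelOp S (integrable_gauss hα) s (kernelOp S (integrable_gauss hα) t f) := by
  ext x
  have hmotion (y z : Rd d) : rot S t (rot S s x - √s • y) - √t • z =
      rot S (s + t) x - (√s • rotIso hS t y + √t • z) := by
    rw [add_comm s t, rot_add, ← sub_sub]
    exact congrArg (· - _) (map_sub (rotCLM S t) _ _ |>.trans
      (congrArg _ (map_smul (rotCLM S t) _ _)))
  simp only [kernelOp_apply, hmotion]
  rw [integral_gauss_smul_comp_isometry α (rotIso hS t) fun y => ∫ z, gauss α z •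
    f.1 (rot S (s + t) x - (√s • y + √t • z))]
  exact (integral_gauss_integral_gauss hα hs ht (h := fun e => f.1 (rot S (s + t) x - e))
    (by fun_prop) fun e => f.1.norm_coe_le_norm _).symm

theorem heatOp_zero (hα : 0 < α.re) (β : ℂ) : (heatOp S hα β 0 : Crub S E →L[ℂ] Crub S E) = 1 := by
  ext1 f
  rw [heatOp, smul_apply, kernelOp_gauss_zero hα, Complex.ofReal_zero, zero_mul, neg_zero,
    Complex.exp_zero, one_smul]
  rfl

theorem heatOp_add (hS : S.transpose = -S) (hα : 0 < α.re) (β : ℂ) {s t : ℝ} (hs : 0 ≤ s)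
    (ht : 0 ≤ t) : (heatOp S hα β (s + t) : Crub S E →L[ℂ] Crub S E) =
      heatOp S hα β s * heatOp S hα β t := by
  rcases hs.eq_or_lt with rfl | hs
  · rw [heatOp_zero, zero_add, one_mul]
  rcases ht.eq_or_lt with rfl | ht
  · rw [heatOp_zero, add_zero, mul_one]
  ext1 f
  rw [mul_apply_eq_comp, heatOp, heatOp, heatOp, smul_apply, smul_apply, smul_apply, map_smul,
    kernelOp_gauss_add hS hα hs ht, smul_smul, ← Complex.exp_add, Complex.ofReal_add, add_mul,
    neg_add]

theorem isC0Semigroup_heatOp (hS : S.transpose = -S) (hα : 0 < α.re) (β : ℂ) :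
    IsC0Semigroup (heatOp S hα β : ℝ → Crub S E →L[ℂ] Crub S E) (∫ y : Rd d, ‖gauss α y‖)
      (-β.re) where
  zero := heatOp_zero hα β
  add hs ht := heatOp_add hS hα β hs ht
  norm_le {t} _ := by
    have hexp : ‖Complex.exp (-(t * β))‖ = Real.exp (-β.re * t) := by
      rw [Complex.norm_exp, Complex.neg_re, Complex.re_ofReal_mul, neg_mul, mul_comm]
    rw [heatOp, norm_smul, mul_comm, hexp]
    gcongr
    exact norm_kernelOp_le _ t
  continuousOn f := by
    have hkernel : Continuous fun t => kernelOp S (integrable_gauss hα) t f :=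
      continuous_kernelOp (k := fun _ => gauss α) (by fun_prop) (fun _ => integrable_gauss hα)
        (integrable_gauss hα).norm (fun _ _ => le_rfl) f
    exact ((by fun_prop : Continuous fun t : ℝ => Complex.exp (-(t * β))).smul hkernel).continuousOn

end HeatOp

section MatrixSemigroup

theorem norm_sum_mul_le {X ι : Type*} [Fintype ι] [NormedAddCommGroup X] [NormedSpace ℂ X]
    {Q K : ι → X →L[ℂ] X} {M : ι → ℝ} {c : ℝ} (hK : ∀ i, ‖K i‖ ≤ M i * c) :
    ‖∑ i, Q i * K i‖ ≤ (∑ i, ‖Q i‖ * M i) * c := by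
  rw [Finset.sum_mul]
  refine norm_sum_le_of_le _ fun i _ => (norm_mul_le _ _).trans ?_
  rw [mul_assoc]
  exact mul_le_mul_of_nonneg_left (hK i) (norm_nonneg _)

theorem isC0Semigroup_sum {X ι : Type*} [Fintype ι] [DecidableEq ι] [NormedAddCommGroup X]
    [NormedSpace ℂ X] {T : ι → ℝ → X →L[ℂ] X} {M w : ι → ℝ} {ω : ℝ} {Q : ι → X →L[ℂ] X}
    (hT : ∀ i, IsC0Semigroup (T i) (M i) (w i)) (hw : ∀ i, w i ≤ ω)
    (hcomm : ∀ i j t, T i t * Q j = Q j * T i t)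
    (hQ : ∀ i j, Q i * Q j = if i = j then Q i else 0) (hQ1 : ∑ i, Q i = 1) :
    IsC0Semigroup (fun t => ∑ i, Q i * T i t) (∑ i, ‖Q i‖ * M i) ω where
  zero := by simp only [(hT _).zero, mul_one, hQ1]
  add {s t} hs ht := by
    have hprod (i j : ι) : Q i * T i s * (Q j * T j t) =
        if i = j then Q i * (T i s * T j t) else 0 := by
      rw [mul_assoc, ← mul_assoc (T i s), hcomm, mul_assoc (Q j), ← mul_assoc, hQ, ite_mul,
        zero_mul]
    simp only [(hT _).add hs ht, Finset.sum_mul_sum, hprod, Finset.sum_ite_eq, Finset.mem_univ,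
      if_true]
  norm_le {t} ht := by
    refine norm_sum_mul_le fun i => ((hT i).norm_le ht).trans ?_
    have hM : 0 ≤ M i := by
      simpa using (norm_nonneg _).trans ((hT i).norm_le le_rfl)
    gcongr
    exact hw i
  continuousOn f := by
    simp only [sum_apply, mul_apply_eq_comp]
    exact continuousOn_finsetSum _ fun i _ => (Q i).continuous.comp_continuousOn
      ((hT i).continuousOn f)

variable {d N : ℕ} {S : Matrix (Fin d) (Fin d) ℝ}

/-- The operator `f ↦ ∫ Y diag(k(y)) Y⁻¹ f(e^{tS}x - √t y) dy` on `C_rub`. -/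
def matrixOp (S : Matrix (Fin d) (Fin d) ℝ) (Y : Matrix (Fin N) (Fin N) ℂ)
    {k : Fin N → Rd d → ℂ} (hk : ∀ j, Integrable (k j)) (t : ℝ) :
    Crub S (CN N) →L[ℂ] Crub S (CN N) :=
  ∑ j, postComp S (specProj Y j) * kernelOp S (hk j) t

theorem matrixOp_apply {Y : Matrix (Fin N) (Fin N) ℂ} (hY : IsUnit Y)
    {k : Fin N → Rd d → ℂ} (hk : ∀ j, Integrable (k j)) (t : ℝ) (f : Crub S (CN N)) (x : Rd d) :
    (matrixOp S Y hk t f).1 x =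
      ∫ y, multiplier Y (fun j => k j y) (f.1 (rot S t x - √t • y)) := by
  have hsum : (matrixOp S Y hk t f).1 x = ∑ j, specProj Y j ((kernelOp S (hk j) t f).1 x) := by
    rw [← evalCLM_apply, matrixOp, sum_apply, map_sum]
    rfl
  have hint (j : Fin N) : Integrable fun y => specProj Y j (k j y • f.1 (rot S t x - √t • y)) :=
    (specProj Y j).integrable_comp (integrable_smul_apply_rot_sub (hk j) t f x)
  simp only [multiplier_eq_sum hY, sum_apply, smul_apply, ← map_smul]
  rw [hsum, integral_finsetSum _ fun j _ => hint j]
  refine Finset.sum_congr rfl fun j _ => ?_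
  rw [kernelOp_apply, ← ContinuousLinearMap.integral_comp_comm _
    (integrable_smul_apply_rot_sub (hk j) t f x)]

/-- The eigenvalues `e^{-t b} gauss a` of the matrix heat kernel, after rescaling space by `√t`. -/
def heatFun (a b : Fin N → ℂ) (t : ℝ) (j : Fin N) (y : Rd d) : ℂ :=
  Complex.exp (-(t * b j)) * gauss (a j) y

theorem integrable_heatFun {a : Fin N → ℂ} (ha : ∀ j, 0 < (a j).re) (b : Fin N → ℂ)
    (t : ℝ) (j : Fin N) : Integrable (heatFun a b t j : Rd d → ℂ) :=
  (integrable_gauss (ha j)).const_mul _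

/-- The Ornstein-Uhlenbeck semigroup on `C_rub`, in the coordinates given by `Y`, in which the
diffusion and potential matrices are `diag(a)` and `diag(b)`. -/
def ouOp (S : Matrix (Fin d) (Fin d) ℝ) (Y : Matrix (Fin N) (Fin N) ℂ) {a : Fin N → ℂ}
    (ha : ∀ j, 0 < (a j).re) (b : Fin N → ℂ) (t : ℝ) : Crub S (CN N) →L[ℂ] Crub S (CN N) :=
  matrixOp S Y (integrable_heatFun ha b t) t

theorem ouOp_eq_sum (Y : Matrix (Fin N) (Fin N) ℂ) {a : Fin N → ℂ} (ha : ∀ j, 0 < (a j).re)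
    (b : Fin N → ℂ) (t : ℝ) :
    ouOp S Y ha b t = ∑ j, postComp S (specProj Y j) * heatOp S (ha j) (b j) t := by
  rw [ouOp, matrixOp]
  refine Finset.sum_congr rfl fun j _ => congrArg (postComp S (specProj Y j) * ·) ?_
  ext1 f
  rw [heatOp, smul_apply, kernelOp_eq, kernelOp_eq, ← integral_smul]
  simp only [heatFun, mul_smul]

theorem exists_isC0Semigroup_ouOp (hS : S.transpose = -S) {Y : Matrix (Fin N) (Fin N) ℂ}
    (hY : IsUnit Y) {a : Fin N → ℂ} (ha : ∀ j, 0 < (a j).re) {b : Fin N → ℂ} {ω : ℝ}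
    (hb : ∀ j, -(b j).re ≤ ω) : ∃ M, IsC0Semigroup (ouOp S Y ha b) M ω := by
  rw [funext (ouOp_eq_sum Y ha b)]
  refine ⟨_, isC0Semigroup_sum (fun j => isC0Semigroup_heatOp hS (ha j) (b j)) hb
    (fun i j t => ?_) (fun i j => ?_) ?_⟩
  · ext1 f
    simp only [heatOp, mul_apply_eq_comp, smul_apply, kernelOp_postComp, map_smul]
  · ext f x : 3
    have := DFunLike.congr_fun (specProj_mul_specProj hY i j) (f.1 x)
    split_ifs at this ⊢ <;> exact this
  · ext f x : 3
    rw [← evalCLM_apply, sum_apply, map_sum]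
    exact (sum_apply _ _ _).symm.trans (DFunLike.congr_fun (sum_specProj hY) (f.1 x))

end MatrixSemigroup

section HeatKernel

theorem ofReal_mul_cpow {t : ℝ} (ht : 0 < t) (z s : ℂ) :
    ((t : ℂ) * z) ^ s = (t : ℂ) ^ s * z ^ s := by
  have ht' : (t : ℂ) ≠ 0 := Complex.ofReal_ne_zero.2 ht.ne'
  rcases eq_or_ne z 0 with rfl | hz
  · rcases eq_or_ne s 0 with rfl | hs
    · simp
    · simp [Complex.zero_cpow hs]
  rw [Complex.cpow_def_of_ne_zero (mul_ne_zero ht' hz), Complex.cpow_def_of_ne_zero ht',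
    Complex.cpow_def_of_ne_zero hz, Complex.log_ofReal_mul ht hz, ← Complex.exp_add,
    ← Complex.ofReal_log ht.le, add_mul]

theorem ofReal_cpow_neg_div_two (d : ℕ) {t : ℝ} (ht : 0 ≤ t) :
    (t : ℂ) ^ (-(d : ℂ) / 2) = ((√t ^ d : ℝ) : ℂ)⁻¹ := by
  have hexponent : -(d : ℂ) / 2 = ((-(d : ℝ) / 2 : ℝ) : ℂ) := by push_cast; ring
  rw [hexponent, ← Complex.ofReal_cpow ht, ← Complex.ofReal_inv, neg_div, Real.rpow_neg ht,
    Real.sqrt_eq_rpow, ← Real.rpow_natCast, ← Real.rpow_mul ht, one_div_mul_eq_div]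

theorem integral_eq_pow_smul_integral_comp_sub_smul {V E : Type*} [NormedAddCommGroup V]
    [InnerProductSpace ℝ V] [FiniteDimensional ℝ V] [MeasurableSpace V] [BorelSpace V]
    [NormedAddCommGroup E] [NormedSpace ℝ E] (F : V → E) (x : V) {r : ℝ} (hr : 0 < r) :
    ∫ ξ, F ξ = r ^ Module.finrank ℝ V • ∫ y, F (x - r • y) := by
  have h := integral_comp_smul_sub (fun z => F (-z)) hr x
  simp only [neg_sub] at h
  rw [h, smul_inv_smul₀ (by positivity), integral_neg_eq_self]

variable {d N : ℕ} {S : Matrix (Fin d) (Fin d) ℝ}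

theorem pow_sqrt_mul_heatCoeff (α β : ℂ) {t : ℝ} (ht : 0 < t) (y : Rd d) :
    ((√t ^ d : ℝ) : ℂ) * heatCoeff d α β t ‖√t • y‖ = Complex.exp (-(t * β)) * gauss α y := by
  have ht' : (t : ℂ) ≠ 0 := Complex.ofReal_ne_zero.2 ht.ne'
  have hscale : ((√t ^ d : ℝ) : ℂ) ≠ 0 := Complex.ofReal_ne_zero.2 (by positivity)
  have hnorm : ((‖√t • y‖ ^ 2 : ℝ) : ℂ) = t * (‖y‖ : ℂ) ^ 2 := by
    rw [norm_smul, mul_pow, Real.norm_eq_abs, sq_abs, Real.sq_sqrt ht.le]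
    push_cast
    rfl
  have hquad : (t : ℂ) * (‖y‖ : ℂ) ^ 2 * (4 * t * α)⁻¹ = (4 * α)⁻¹ * (‖y‖ : ℂ) ^ 2 := by
    rw [mul_right_comm 4, mul_inv _ (t : ℂ)]
    field_simp
  rw [heatCoeff, hnorm, hquad, sub_eq_add_neg, Complex.exp_add, gauss, finrank_euclideanSpace_fin,
    show (4 * Real.pi * t * α : ℂ) = t * (4 * Real.pi * α) by ring, ofReal_mul_cpow ht,
    ofReal_cpow_neg_div_two d ht.le, neg_mul]
  field_simp

theorem SpectralData.semigroup_eq {A B Y : Matrix (Fin N) (Fin N) ℂ} {a b : Fin N → ℂ}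
    (h : SpectralData A B Y a b) {t : ℝ} (ht : 0 < t) (f : Crub S (CN N)) (x : Rd d) :
    semigroup A B S t f.1 x = (ouOp S Y h.re_pos b t f).1 x := by
  have hscale (y : Rd d) : (fun j => heatFun a b t j y) =
      ((√t ^ d : ℝ) : ℂ) • fun j => heatCoeff d (a j) (b j) t ‖√t • y‖ :=
    funext fun j => (pow_sqrt_mul_heatCoeff (a j) (b j) ht y).symm
  rw [semigroup, if_pos ht, ouOp, matrixOp_apply h.isUnit,
    integral_eq_pow_smul_integral_comp_sub_smul _ (rot S t x) (Real.sqrt_pos.2 ht),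
    finrank_euclideanSpace_fin, ← integral_smul]
  congr with y : 1
  rw [h.heatKernel_mulVec S x _ ht, sub_sub_cancel, hscale, multiplier_eq h.isUnit,
    multiplier_eq h.isUnit, map_smul, map_smul, smul_apply, Complex.coe_smul]

end HeatKernel

/-! ### The gradient of the semigroup -/

section HeatGradOp

variable {d : ℕ} {S : Matrix (Fin d) (Fin d) ℝ} {E : Type*} [NormedAddCommGroup E]
  [NormedSpace ℝ E] [NormedSpace ℂ E] [IsScalarTower ℝ ℂ E] {α : ℂ}

/-- The derivative of `heatOp` in the direction `e`, as an operator on `C_rub`. -/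
def heatGradOp (S : Matrix (Fin d) (Fin d) ℝ) (hα : 0 < α.re) (β : ℂ) (e : Rd d) (t : ℝ) :
    Crub S E →L[ℂ] Crub S E :=
  (((√t)⁻¹ : ℝ) * Complex.exp (-(t * β))) •
    kernelOp S ((integrable_dgauss hα).apply_continuousLinearMap (rot S t e)) t

theorem norm_heatGradOp_le (hS : S.transpose = -S) (hα : 0 < α.re) (β : ℂ) (e : Rd d) (t : ℝ) :
    ‖(heatGradOp S hα β e t : Crub S E →L[ℂ] Crub S E)‖ ≤
      (∫ y : Rd d, ‖dgauss α y‖) * ‖e‖ * ((√t)⁻¹ * Real.exp (-β.re * t)) := by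
  have hfactor : ‖(((√t)⁻¹ : ℝ) * Complex.exp (-(t * β)) : ℂ)‖ =
      (√t)⁻¹ * Real.exp (-β.re * t) := by
    rw [norm_mul, Complex.norm_real, Real.norm_of_nonneg (by positivity), Complex.norm_exp,
      Complex.neg_re, Complex.re_ofReal_mul, neg_mul, mul_comm t]
  refine (ContinuousLinearMap.opNorm_smul_le _ _).trans ?_
  rw [hfactor, mul_comm]
  gcongr
  refine (norm_kernelOp_le _ t).trans ?_
  rw [← integral_mul_const]
  refine integral_mono ((integrable_dgauss hα).apply_continuousLinearMap _).norm
    ((integrable_dgauss hα).norm.mul_const _) fun y => ?_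
  simpa only [norm_rot hS] using (dgauss α y).le_opNorm (rot S t e)

theorem continuousOn_heatGradOp (hS : S.transpose = -S) (hα : 0 < α.re) (β : ℂ) (e : Rd d)
    (f : Crub S E) : ContinuousOn (fun t => heatGradOp S hα β e t f) (Set.Ioi 0) := by
  have hfactor : ContinuousOn (fun t : ℝ => (((√t)⁻¹ : ℝ) * Complex.exp (-(t * β)) : ℂ))
      (Set.Ioi 0) :=
    (Complex.continuous_ofReal.comp_continuousOn
      (Real.continuous_sqrt.continuousOn.inv₀ fun t ht => (Real.sqrt_pos.2 ht).ne')).mul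
      (by fun_prop : Continuous fun t : ℝ => Complex.exp (-(t * β))).continuousOn
  have hrot : Continuous fun p : ℝ × Rd d => rot S p.1 e :=
    (continuous_rot S).comp (by fun_prop : Continuous fun p : ℝ × Rd d => (p.1, e))
  refine hfactor.smul (continuous_kernelOp (k := fun t y => dgauss α y (rot S t e))
    (((continuous_dgauss α).comp continuous_snd).clm_apply hrot)
    (fun t => (integrable_dgauss hα).apply_continuousLinearMap (rot S t e))
    ((integrable_dgauss hα).norm.mul_const ‖e‖) (fun t y => ?_) f).continuousOn
  simpa only [norm_rot hS] using (dgauss α y).le_opNorm (rot S t e)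

variable [CompleteSpace E]

theorem hasFDerivAt_kernelOp_gauss (hα : 0 < α.re) {t : ℝ} (ht : 0 < t) (f : Crub S E)
    (x : Rd d) : HasFDerivAt (fun x => (kernelOp S (integrable_gauss hα) t f).1 x)
      ((∫ y, (dgauss α y).smulRight (f.1 (rot S t x - √t • y))).comp ((√t)⁻¹ • rotCLM S t)) x := by
  have hscale (x y : Rd d) : √t • ((√t)⁻¹ • rot S t x - y) = rot S t x - √t • y := by
    rw [smul_sub, smul_inv_smul₀ (Real.sqrt_pos.2 ht).ne']
  obtain ⟨g, hg, hdg⟩ := exists_integrable_forall_norm_dgauss_le (V := Rd d) hα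
  have hconv := hasFDerivAt_integral_smul_comp_sub (integrable_gauss hα) (hasFDerivAt_gauss α)
    (continuous_dgauss α) hg hdg (h := fun y => f.1 (√t • y)) (by fun_prop)
    (fun y => f.1.norm_coe_le_norm _) ((√t)⁻¹ • rot S t x)
  have hcomp := hconv.comp x ((√t)⁻¹ • rotCLM S t).hasFDerivAt
  simp only [hscale] at hcomp
  refine hcomp.congr_of_eventuallyEq (Eventually.of_forall fun z => ?_)
  simp only [kernelOp_apply, ← hscale z]
  rfl

theorem exists_hasFDerivAt_heatOp (hα : 0 < α.re) (β : ℂ) {t : ℝ} (ht : 0 < t) (f : Crub S E)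
    (x : Rd d) : ∃ L : Rd d →L[ℝ] E, HasFDerivAt (fun x => (heatOp S hα β t f).1 x) L x ∧
      ∀ e, L e = (heatGradOp S hα β e t f).1 x := by
  have hint : Integrable fun y => (dgauss α y).smulRight (f.1 (rot S t x - √t • y)) := by
    refine ((integrable_dgauss hα).norm.mul_const ‖f‖).mono'
      (continuous_smulRight (continuous_dgauss α) (by fun_prop)).aestronglyMeasurable
      (Eventually.of_forall fun y => (norm_smulRight_le _ _).trans ?_)
    gcongr
    exact f.1.norm_coe_le_norm _
  refine ⟨_, (hasFDerivAt_kernelOp_gauss hα ht f x).const_smul (Complex.exp (-(t * β))),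
    fun e => ?_⟩
  rw [← evalCLM_apply, heatGradOp, smul_apply, smul_apply, map_smul, evalCLM_apply,
    kernelOp_apply, mul_smul, ← Complex.coe_algebraMap, algebraMap_smul, smul_comm,
    ContinuousLinearMap.comp_apply, smul_apply, map_smul, ← rot_eq,
    ContinuousLinearMap.integral_apply hint]
  rfl

end HeatGradOp

section MatrixGradient

variable {d N : ℕ} {S : Matrix (Fin d) (Fin d) ℝ}

/-- The eigenvalues of the derivative of the matrix heat kernel in the direction `e`, after
rescaling space by `√t`. -/
def gradFun (S : Matrix (Fin d) (Fin d) ℝ) (a b : Fin N → ℂ) (e : Rd d) (t : ℝ) (j : Fin N)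
    (y : Rd d) : ℂ :=
  ((√t)⁻¹ : ℝ) * Complex.exp (-(t * b j)) * dgauss (a j) y (rot S t e)

theorem integrable_gradFun {a : Fin N → ℂ} (ha : ∀ j, 0 < (a j).re) (b : Fin N → ℂ) (e : Rd d)
    (t : ℝ) (j : Fin N) : Integrable (gradFun S a b e t j) :=
  ((integrable_dgauss (ha j)).apply_continuousLinearMap (rot S t e)).const_mul _

/-- The directional derivative `D_e T(t)` of the Ornstein-Uhlenbeck semigroup, as an operator on
`C_rub`. -/
def gradOp (S : Matrix (Fin d) (Fin d) ℝ) (Y : Matrix (Fin N) (Fin N) ℂ) {a : Fin N → ℂ}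
    (ha : ∀ j, 0 < (a j).re) (b : Fin N → ℂ) (e : Rd d) (t : ℝ) :
    Crub S (CN N) →L[ℂ] Crub S (CN N) :=
  matrixOp S Y (integrable_gradFun (S := S) ha b e t) t

variable (Y : Matrix (Fin N) (Fin N) ℂ) {a : Fin N → ℂ} (ha : ∀ j, 0 < (a j).re) {b : Fin N → ℂ}

theorem gradOp_eq_sum (b : Fin N → ℂ) (e : Rd d) (t : ℝ) : gradOp S Y ha b e t =
    ∑ j, postComp S (specProj Y j) * heatGradOp S (ha j) (b j) e t := by
  rw [gradOp, matrixOp]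
  refine Finset.sum_congr rfl fun j _ => congrArg (postComp S (specProj Y j) * ·) ?_
  ext1 f
  rw [heatGradOp, smul_apply, kernelOp_eq, kernelOp_eq, ← integral_smul]
  simp only [gradFun, mul_smul]

theorem exists_hasFDerivAt_ouOp (b : Fin N → ℂ) {t : ℝ} (ht : 0 < t) (f : Crub S (CN N))
    (x : Rd d) : ∃ L : Rd d →L[ℝ] CN N, HasFDerivAt (fun x => (ouOp S Y ha b t f).1 x) L x ∧
      ∀ e, L e = (gradOp S Y ha b e t f).1 x := by
  choose L hL hLe using fun j => exists_hasFDerivAt_heatOp (ha j) (b j) ht f x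
  have hsum := HasFDerivAt.sum (u := Finset.univ) fun j _ =>
    ((specProj Y j).restrictScalars ℝ).hasFDerivAt.comp x (hL j)
  refine ⟨_, hsum.congr_of_eventuallyEq (Eventually.of_forall fun z => ?_), fun e => ?_⟩
  · rw [Finset.sum_apply]
    change evalCLM S (CN N) z (ouOp S Y ha b t f) = _
    rw [ouOp_eq_sum, sum_apply, map_sum]
    rfl
  · rw [← evalCLM_apply, gradOp_eq_sum, sum_apply, sum_apply, map_sum]
    exact Finset.sum_congr rfl fun j _ => congrArg (specProj Y j) (hLe j e)

theorem exists_forall_norm_gradOp_le (hS : S.transpose = -S) {ω : ℝ} (hb : ∀ j, -(b j).re ≤ ω)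
    (e : Rd d) : ∃ M, ∀ t, 0 < t → ‖gradOp S Y ha b e t‖ ≤ M * ((√t)⁻¹ * Real.exp (ω * t)) := by
  refine ⟨∑ j, ‖(postComp S (specProj Y j) : Crub S (CN N) →L[ℂ] Crub S (CN N))‖ *
    ((∫ y : Rd d, ‖dgauss (a j) y‖) * ‖e‖), fun t ht => ?_⟩
  rw [gradOp_eq_sum]
  refine norm_sum_mul_le fun j => (norm_heatGradOp_le hS (ha j) (b j) e t).trans ?_
  gcongr
  exact hb j

theorem continuousOn_gradOp (hS : S.transpose = -S) (b : Fin N → ℂ) (e : Rd d)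
    (f : Crub S (CN N)) : ContinuousOn (fun t => gradOp S Y ha b e t f) (Set.Ioi 0) := by
  simp only [gradOp_eq_sum, sum_apply, mul_apply_eq_comp]
  exact continuousOn_finsetSum _ fun j _ => (postComp S (specProj Y j)).continuous.comp_continuousOn
    (continuousOn_heatGradOp hS (ha j) (b j) e f)

end MatrixGradient

section Partials

variable {d : ℕ} {E : Type*} [NormedAddCommGroup E] [NormedSpace ℝ E]

/-- The identification of a linear map on `ℝ^d` with the family of its values on the standard basis,
that is, of a derivative with the family of partial derivatives. -/
def partials (d : ℕ) (E : Type*) [NormedAddCommGroup E] [NormedSpace ℝ E] :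
    (Rd d →L[ℝ] E) ≃L[ℝ] (Fin d → E) :=
  ((EuclideanSpace.equiv (Fin d) ℝ).arrowCongr (.refl ℝ E)).trans (.piRing (Fin d))

theorem partials_apply (L : Rd d →L[ℝ] E) (i : Fin d) :
    partials d E L i = L (EuclideanSpace.single i 1) := rfl

theorem contDiff_one_of_hasFDerivAt_partials_symm {v : Rd d → E} {w : Fin d → Rd d → E}
    (hw : ∀ i, Continuous (w i)) (h : ∀ x, HasFDerivAt v ((partials d E).symm fun i => w i x) x) :
    ContDiff ℝ 1 v := by
  rw [contDiff_one_iff_fderiv]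
  refine ⟨fun x => (h x).differentiableAt, ?_⟩
  rw [funext fun x => (h x).fderiv]
  exact (partials d E).symm.continuous.comp (continuous_pi hw)

end Partials

section Derivative

variable {d : ℕ} {S : Matrix (Fin d) (Fin d) ℝ} {E : Type*} [NormedAddCommGroup E]
  [NormedSpace ℂ E] {μ : Measure ℝ} {F : ℝ → Crub S E}

theorem integrable_crub_apply (hF : Integrable F μ) (x : Rd d) :
    Integrable (fun t => (F t).1 x) μ :=
  (evalCLM S E x).integrable_comp hF

variable [NormedSpace ℝ E] [IsScalarTower ℝ ℂ E] [CompleteSpace E]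

theorem integral_crub_apply (hF : Integrable F μ) (x : Rd d) :
    (∫ t, F t ∂μ).1 x = ∫ t, (F t).1 x ∂μ := by
  rw [← evalCLM_apply, ← ContinuousLinearMap.integral_comp_comm _ hF]
  rfl

theorem hasFDerivAt_integral_crub {ι : Type*} [Finite ι] (P : (ι → E) →L[ℝ] Rd d →L[ℝ] E)
    {G : ι → ℝ → Crub S E} (hF : Integrable F μ) (hG : ∀ i, Integrable (G i) μ)
    (h : ∀ᵐ t ∂μ, ∀ x, HasFDerivAt (fun x => (F t).1 x) (P fun i => (G i t).1 x) x) (x : Rd d) :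
    HasFDerivAt (fun x => (∫ t, F t ∂μ).1 x) (P fun i => (∫ t, G i t ∂μ).1 x) x := by
  have := Fintype.ofFinite ι
  have hGx : Integrable (fun t i => (G i t).1 x) μ :=
    .of_eval fun i => integrable_crub_apply (hG i) x
  have hpartials : (P fun i => (∫ t, G i t ∂μ).1 x) = ∫ t, P (fun i => (G i t).1 x) ∂μ := by
    rw [P.integral_comp_comm hGx]
    congr 1 with i : 1
    rw [eval_integral fun i => integrable_crub_apply (hG i) x, integral_crub_apply (hG i)]
  simp only [integral_crub_apply hF, hpartials]
  refine hasFDerivAt_integral_of_dominated_of_fderiv_le (𝕜 := ℝ)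
    (F' := fun x t => P fun i => (G i t).1 x) (bound := fun t => ‖P‖ * ‖fun i => G i t‖) univ_mem
    (Eventually.of_forall fun x => (integrable_crub_apply hF x).aestronglyMeasurable)
    (integrable_crub_apply hF x) (P.integrable_comp hGx).aestronglyMeasurable
    (Eventually.of_forall fun t x _ => ?_) ((Integrable.of_eval hG).norm.const_mul _)
    (h.mono fun t ht x _ => ht x)
  refine P.le_opNorm_of_le ((pi_norm_le_iff_of_nonneg (norm_nonneg _)).2 fun i => ?_)
  exact ((G i t).1.norm_coe_le_norm x).trans (norm_le_pi_norm (fun i => G i t) i)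

end Derivative

section LaplaceDerivative

theorem inv_sqrt_eq_rpow {t : ℝ} (ht : 0 ≤ t) : (√t)⁻¹ = t ^ ((1 : ℝ) / 2 - 1) := by
  rw [Real.sqrt_eq_rpow, ← Real.rpow_neg ht]
  norm_num

theorem integrableOn_laplaceOrbit_of_norm_le_inv_sqrt {X : Type*} [NormedAddCommGroup X]
    [NormedSpace ℂ X] {T : ℝ → X →L[ℂ] X} {ω M : ℝ} {lam : ℂ} (hlam : ω < lam.re) {g : X}
    (hT : ContinuousOn (fun t => T t g) (Set.Ioi 0))
    (hM : ∀ t, 0 < t → ‖T t‖ ≤ M * ((√t)⁻¹ * Real.exp (ω * t))) :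
    IntegrableOn (laplaceOrbit T lam g) (Set.Ioi 0) := by
  have hcont : ContinuousOn (laplaceOrbit T lam g) (Set.Ioi 0) :=
    (by fun_prop : Continuous fun t : ℝ => Complex.exp (-(lam * t))).continuousOn.smul hT
  refine Integrable.mono' ((integrableOn_rpow_mul_exp_neg (a := 1 / 2) (by norm_num)
    (sub_pos.2 hlam)).const_mul (M * ‖g‖)) (hcont.aestronglyMeasurable measurableSet_Ioi) ?_
  filter_upwards [ae_restrict_mem measurableSet_Ioi] with t (ht : 0 < t)
  calc ‖laplaceOrbit T lam g t‖ = Real.exp (-(lam.re * t)) * ‖T t g‖ := by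
        simp [laplaceOrbit, norm_smul, Complex.norm_exp]
    _ ≤ Real.exp (-(lam.re * t)) * (M * ((√t)⁻¹ * Real.exp (ω * t)) * ‖g‖) := by
        gcongr
        exact (T t).le_of_opNorm_le (hM t ht) g
    _ = _ := by
        rw [inv_sqrt_eq_rpow ht.le,
          show -((lam.re - ω) * t) = -(lam.re * t) + ω * t by ring, Real.exp_add]
        ring

variable {d N : ℕ} {S : Matrix (Fin d) (Fin d) ℝ} {Y : Matrix (Fin N) (Fin N) ℂ} {a b : Fin N → ℂ}
  (ha : ∀ j, 0 < (a j).re) {ω : ℝ} {lam : ℂ}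

theorem integrableOn_laplaceOrbit_gradOp (hS : S.transpose = -S) (Y : Matrix (Fin N) (Fin N) ℂ)
    (hb : ∀ j, -(b j).re ≤ ω) (hlam : ω < lam.re) (g : Crub S (CN N)) (e : Rd d) :
    IntegrableOn (laplaceOrbit (gradOp S Y ha b e) lam g) (Set.Ioi 0) := by
  obtain ⟨M, hM⟩ := exists_forall_norm_gradOp_le Y ha hS hb e
  exact integrableOn_laplaceOrbit_of_norm_le_inv_sqrt hlam (continuousOn_gradOp Y ha hS b e g) hM

theorem hasFDerivAt_laplace_ouOp (hS : S.transpose = -S) (hY : IsUnit Y)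
    (hb : ∀ j, -(b j).re ≤ ω) (hlam : ω < lam.re) (g : Crub S (CN N)) (x : Rd d) :
    HasFDerivAt (fun x => (laplace (ouOp S Y ha b) lam g).1 x) ((partials d (CN N)).symm fun i =>
      (laplace (gradOp S Y ha b (EuclideanSpace.single i 1)) lam g).1 x) x := by
  obtain ⟨M, hT⟩ := exists_isC0Semigroup_ouOp hS hY ha hb
  refine hasFDerivAt_integral_crub ((partials d (CN N)).symm : _ →L[ℝ] _)
    (integrableOn_laplaceOrbit hT hlam g)
    (fun i => integrableOn_laplaceOrbit_gradOp ha hS Y hb hlam g (EuclideanSpace.single i 1)) ?_ x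
  filter_upwards [ae_restrict_mem measurableSet_Ioi] with t ht x
  obtain ⟨L, hL, hLe⟩ := exists_hasFDerivAt_ouOp Y ha b ht g x
  have hpartials : Complex.exp (-(lam * t)) • L = (partials d (CN N)).symm fun i =>
      (laplaceOrbit (gradOp S Y ha b (EuclideanSpace.single i 1)) lam g t).1 x := by
    rw [ContinuousLinearEquiv.eq_symm_apply]
    ext1 i
    rw [partials_apply, smul_apply, hLe]
    rfl
  have hderiv := hL.const_smul (Complex.exp (-(lam * t)))
  rw [hpartials] at hderiv
  exact hderiv

end LaplaceDerivative

/-! ### Weighted estimates -/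

section Weight

variable {d N : ℕ} {S : Matrix (Fin d) (Fin d) ℝ} {θ : Rd d → ℝ} {η Cθ : ℝ}
  (hθ : IsRadialWeight θ η Cθ)
include hθ

theorem IsRadialWeight.rot_eq (hS : S.transpose = -S) (t : ℝ) (x : Rd d) :
    θ (rot S t x) = θ x := by
  obtain ⟨φ, hφ⟩ := hθ.radial
  rw [hφ, hφ, show ‖rot S t x‖₊ = ‖x‖₊ from NNReal.eq (norm_rot hS t x)]

theorem IsRadialWeight.le_mul_exp (hS : S.transpose = -S) (t : ℝ) (x y : Rd d) :
    θ x ≤ Cθ * θ (rot S t x - √t • y) * Real.exp (η * √t * ‖y‖) := by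
  have hgrowth := hθ.growth (rot S t x - √t • y) (√t • y)
  rwa [sub_add_cancel, hθ.rot_eq hS, norm_smul, Real.norm_of_nonneg (Real.sqrt_nonneg t),
    ← mul_assoc] at hgrowth

variable {g : Rd d → CN N} {G : ℝ} (hg : ∀ x, θ x * ‖g x‖ ≤ G)
include hg

theorem IsRadialWeight.norm_apply_rot_sub_le (hS : S.transpose = -S) (t : ℝ) (x y : Rd d) :
    ‖g (rot S t x - √t • y)‖ ≤ Cθ * G / θ x * Real.exp (η * √t * ‖y‖) := by
  have := hθ.const_pos
  rw [div_mul_eq_mul_div, le_div_iff₀ (hθ.pos x)]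
  calc ‖g (rot S t x - √t • y)‖ * θ x
      ≤ ‖g (rot S t x - √t • y)‖ * (Cθ * θ (rot S t x - √t • y) * Real.exp (η * √t * ‖y‖)) := by
        gcongr
        exact hθ.le_mul_exp hS t x y
    _ = Cθ * (θ (rot S t x - √t • y) * ‖g (rot S t x - √t • y)‖) * Real.exp (η * √t * ‖y‖) := by
        ring
    _ ≤ Cθ * G * Real.exp (η * √t * ‖y‖) := by
        gcongr
        exact hg _

theorem IsRadialWeight.bound_nonneg (x : Rd d) : 0 ≤ Cθ * G / θ x := by
  have := hθ.const_pos
  have := hθ.pos x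
  have : 0 ≤ G := (mul_nonneg (hθ.pos x).le (norm_nonneg _)).trans (hg x)
  positivity

end Weight

section WeightedLaplace

variable {d N : ℕ} {S : Matrix (Fin d) (Fin d) ℝ} {Y : Matrix (Fin N) (Fin N) ℂ} {θ : Rd d → ℝ}
  {η Cθ : ℝ} {g : Crub S (CN N)} {G K : ℝ} {m : ℕ}

theorem enorm_matrixOp_apply_le (hθ : IsRadialWeight θ η Cθ) (hg : ∀ x, θ x * ‖g.1 x‖ ≤ G)
    (hS : S.transpose = -S) (hY : IsUnit Y) {k : Fin N → Rd d → ℂ} (hk : ∀ j, Integrable (k j))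
    {c : ℝ} (hc : 0 ≤ c)
    (hkc : ∀ j y, ‖k j y‖ ≤ c * (‖y‖ ^ m * Real.exp (-‖y‖ ^ 2 / (4 * K)))) (t : ℝ) (x : Rd d) :
    ‖(matrixOp S Y hk t g).1 x‖ₑ ≤ ENNReal.ofReal (cond Y * c * (Cθ * G / θ x)) *
      ∫⁻ y : Rd d, ENNReal.ofReal
        (‖y‖ ^ m * Real.exp (η * √t * ‖y‖) * Real.exp (-‖y‖ ^ 2 / (4 * K))) := by
  have := hθ.bound_nonneg hg x
  have := cond_nonneg Y
  have hpoint (y : Rd d) : ‖multiplier Y (fun j => k j y) (g.1 (rot S t x - √t • y))‖ ≤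
      cond Y * c * (Cθ * G / θ x) *
        (‖y‖ ^ m * Real.exp (η * √t * ‖y‖) * Real.exp (-‖y‖ ^ 2 / (4 * K))) :=
    calc _ ≤ cond Y * (c * (‖y‖ ^ m * Real.exp (-‖y‖ ^ 2 / (4 * K)))) *
          (Cθ * G / θ x * Real.exp (η * √t * ‖y‖)) :=
          ContinuousLinearMap.le_of_opNorm_le_of_le _
            (norm_multiplier_le Y (by positivity) fun j => hkc j y)
            (hθ.norm_apply_rot_sub_le hg hS t x y)
      _ = _ := by ring
  rw [matrixOp_apply hY, ← lintegral_const_mul' _ _ ENNReal.ofReal_ne_top]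
  refine (enorm_integral_le_lintegral_enorm _).trans (lintegral_mono fun y => ?_)
  rw [← ENNReal.ofReal_mul (by positivity), ← ofReal_norm]
  exact ENNReal.ofReal_le_ofReal (hpoint y)

theorem enorm_laplaceOrbit_matrixOp_apply_le (hθ : IsRadialWeight θ η Cθ)
    (hg : ∀ x, θ x * ‖g.1 x‖ ≤ G) (hS : S.transpose = -S) (hY : IsUnit Y)
    {k : ℝ → Fin N → Rd d → ℂ} (hk : ∀ t j, Integrable (k t j)) {c r ω : ℝ} (lam : ℂ)
    (hc : 0 ≤ c) {t : ℝ} (ht : 0 < t) (hkc : ∀ j y, ‖k t j y‖ ≤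
      c * (t ^ (r - 1) * Real.exp (ω * t)) * (‖y‖ ^ m * Real.exp (-‖y‖ ^ 2 / (4 * K)))) (x : Rd d) :
    ‖(laplaceOrbit (fun t => matrixOp S Y (hk t) t) lam g t).1 x‖ₑ ≤
      ENNReal.ofReal (cond Y * c * (Cθ * G / θ x)) *
        (ENNReal.ofReal (t ^ (r - 1) * Real.exp (-((lam.re - ω) * t))) *
          ∫⁻ y : Rd d, ENNReal.ofReal
            (‖y‖ ^ m * Real.exp (η * √t * ‖y‖) * Real.exp (-‖y‖ ^ 2 / (4 * K)))) := by
  have := hθ.bound_nonneg hg x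
  have := cond_nonneg Y
  have hexp : ‖Complex.exp (-(lam * t))‖ₑ = ENNReal.ofReal (Real.exp (-(lam.re * t))) := by
    rw [← ofReal_norm, Complex.norm_exp, Complex.neg_re, Complex.re_mul_ofReal]
  change ‖Complex.exp (-(lam * t)) • (matrixOp S Y (hk t) t g).1 x‖ₑ ≤ _
  rw [enorm_smul, hexp]
  refine (mul_le_mul_right
    (enorm_matrixOp_apply_le hθ hg hS hY (hk t) (by positivity) hkc t x) _).trans_eq ?_
  rw [← mul_assoc, ← ENNReal.ofReal_mul (by positivity), ← mul_assoc (ENNReal.ofReal _),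
    ← ENNReal.ofReal_mul (by positivity),
    show -((lam.re - ω) * t) = -(lam.re * t) + ω * t by ring, Real.exp_add]
  congr 2
  ring

theorem norm_laplace_matrixOp_apply_le [Nontrivial (Rd d)] (hθ : IsRadialWeight θ η Cθ)
    (hg : ∀ x, θ x * ‖g.1 x‖ ≤ G) (hS : S.transpose = -S) (hY : IsUnit Y)
    {k : ℝ → Fin N → Rd d → ℂ} (hk : ∀ t j, Integrable (k t j)) {c r ω ϑ : ℝ} {lam : ℂ}
    (hint : IntegrableOn (laplaceOrbit (fun t => matrixOp S Y (hk t) t) lam g) (Set.Ioi 0))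
    (hc : 0 ≤ c) (hkc : ∀ t, 0 < t → ∀ j y, ‖k t j y‖ ≤
      c * (t ^ (r - 1) * Real.exp (ω * t)) * (‖y‖ ^ m * Real.exp (-‖y‖ ^ 2 / (4 * K))))
    (hlam : ω < lam.re) (hK : 0 < K) (hη : η ^ 2 * K ≤ ϑ * (lam.re - ω)) (hϑ0 : 0 < ϑ)
    (hϑ1 : ϑ < 1) (hr : 0 < r) (x : Rd d) :
    ‖(laplace (fun t => matrixOp S Y (hk t) t) lam g).1 x‖ ≤ cond Y * c * (Cθ * G / θ x) *
      ((1 / (lam.re - ω)) ^ r * Real.pi ^ ((d : ℝ) / 2) * (4 * K) ^ (((d : ℝ) + m) / 2) /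
        Real.Gamma ((d : ℝ) / 2) * expMoment (((d : ℝ) + m) / 2) r ϑ) := by
  have := hθ.bound_nonneg hg x
  have := cond_nonneg Y
  have hw := sub_pos.2 hlam
  have hd : (0 : ℝ) < d := by
    rw [← finrank_euclideanSpace_fin (𝕜 := ℝ) (n := d)]
    exact_mod_cast Module.finrank_pos
  have := Real.Gamma_pos_of_pos (half_pos hd)
  have := expMoment_nonneg (by positivity : 0 < ((d : ℝ) + m) / 2) hr hϑ0 hϑ1
  rw [← ENNReal.ofReal_le_ofReal_iff (by positivity), ENNReal.ofReal_mul (by positivity),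
    ofReal_norm, laplace, integral_crub_apply hint]
  refine ((enorm_integral_le_lintegral_enorm _).trans
    (setLIntegral_mono' measurableSet_Ioi fun t ht =>
      enorm_laplaceOrbit_matrixOp_apply_le hθ hg hS hY hk lam hc ht (hkc t ht) x)).trans ?_
  rw [lintegral_const_mul' _ _ ENNReal.ofReal_ne_top]
  exact mul_le_mul_right (lintegral_rpow_mul_exp_mul_lintegral_le
    finrank_euclideanSpace_fin m hK hw hθ.rate_nonneg hη hϑ0 hϑ1 hr) _

end WeightedLaplace

section KernelBounds

variable {d N : ℕ} {S : Matrix (Fin d) (Fin d) ℝ} {a b : Fin N → ℂ} {am K ω : ℝ}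

theorem norm_exp_potential_le (hb : ∀ j, -(b j).re ≤ ω) {t : ℝ} (ht : 0 < t) (j : Fin N) :
    ‖Complex.exp (-(t * b j))‖ ≤ Real.exp (ω * t) := by
  rw [Complex.norm_exp, Complex.neg_re, Complex.re_ofReal_mul]
  refine Real.exp_le_exp.2 ?_
  linarith [mul_le_mul_of_nonneg_right (hb j) ht.le]

variable (ham : 0 < am) (hK : 0 < K) (haam : ∀ j, am ≤ ‖a j‖) (haK : ∀ j, ‖a j‖ ^ 2 ≤ K * (a j).re)
  (hb : ∀ j, -(b j).re ≤ ω)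
include ham hK haam haK hb

theorem norm_heatFun_le {t : ℝ} (ht : 0 < t) (j : Fin N) (y : Rd d) :
    ‖heatFun a b t j y‖ ≤ (4 * Real.pi * am) ^ (-(d : ℝ) / 2) *
      (t ^ ((1 : ℝ) - 1) * Real.exp (ω * t)) * (‖y‖ ^ 0 * Real.exp (-‖y‖ ^ 2 / (4 * K))) := by
  have hgauss := norm_gauss_le ham (haam j) hK (haK j) y
  rw [finrank_euclideanSpace_fin] at hgauss
  rw [heatFun, norm_mul, sub_self, Real.rpow_zero, pow_zero]
  refine (mul_le_mul (norm_exp_potential_le hb ht j) hgauss (norm_nonneg _)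
    (Real.exp_pos _).le).trans_eq ?_
  ring

theorem norm_gradFun_le (hS : S.transpose = -S) {e : Rd d} (he : ‖e‖ = 1) {t : ℝ} (ht : 0 < t)
    (j : Fin N) (y : Rd d) :
    ‖gradFun S a b e t j y‖ ≤ (2 * am)⁻¹ * (4 * Real.pi * am) ^ (-(d : ℝ) / 2) *
      (t ^ ((1 : ℝ) / 2 - 1) * Real.exp (ω * t)) *
        (‖y‖ ^ 1 * Real.exp (-‖y‖ ^ 2 / (4 * K))) := by
  have hgauss := norm_gauss_le ham (haam j) hK (haK j) y
  rw [finrank_euclideanSpace_fin] at hgauss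
  have hdgauss : ‖dgauss (a j) y (rot S t e)‖ ≤ (2 * am)⁻¹ *
      (‖y‖ * ((4 * Real.pi * am) ^ (-(d : ℝ) / 2) * Real.exp (-‖y‖ ^ 2 / (4 * K)))) := by
    have hunit := (dgauss (a j) y).le_opNorm (rot S t e)
    rw [norm_rot hS, he, mul_one] at hunit
    refine hunit.trans ((norm_dgauss_le (a j) y).trans ?_)
    gcongr
    exact haam j
  rw [gradFun, norm_mul, norm_mul, Complex.norm_real, Real.norm_of_nonneg (by positivity),
    inv_sqrt_eq_rpow ht.le, pow_one]
  calc _ ≤ t ^ ((1 : ℝ) / 2 - 1) * Real.exp (ω * t) * ((2 * am)⁻¹ *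
        (‖y‖ * ((4 * Real.pi * am) ^ (-(d : ℝ) / 2) * Real.exp (-‖y‖ ^ 2 / (4 * K))))) := by
        gcongr
        exact norm_exp_potential_le hb ht j
    _ = _ := by ring

end KernelBounds

/-! ### The constants `C_7` and `C_8` -/

section Constants

theorem rpow_prefactor {am K : ℝ} (ham : 0 < am) (hK : 0 < K) (p : ℝ) :
    (4 * Real.pi * am) ^ (-p) * Real.pi ^ p * (4 * K) ^ p = (K / am) ^ p := by
  have := Real.pi_pos
  rw [Real.rpow_neg (by positivity), ← Real.inv_rpow (by positivity),
    ← Real.mul_rpow (by positivity) (by positivity),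
    ← Real.mul_rpow (by positivity) (by positivity)]
  congr 1
  field_simp

theorem rpow_prefactor_half {am K : ℝ} (ham : 0 < am) (hK : 0 < K) (p : ℝ) :
    (2 * am)⁻¹ * ((4 * Real.pi * am) ^ (-p) * Real.pi ^ p * (4 * K) ^ (p + 1 / 2)) =
      (K / am) ^ (p + 1 / 2) / am ^ ((1 : ℝ) / 2) := by
  have hhalf : (2 * am)⁻¹ * (4 * K) ^ ((1 : ℝ) / 2) =
      (K / am) ^ ((1 : ℝ) / 2) / am ^ ((1 : ℝ) / 2) := by
    rw [← Real.sqrt_eq_rpow, ← Real.sqrt_eq_rpow, ← Real.sqrt_eq_rpow, Real.sqrt_mul (by norm_num),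
      Real.sqrt_div hK.le, show (4 : ℝ) = 2 ^ 2 by norm_num, Real.sqrt_sq (by norm_num), div_div,
      Real.mul_self_sqrt ham.le]
    field_simp
  rw [Real.rpow_add (by positivity), Real.rpow_add (by positivity), mul_div_assoc, ← hhalf,
    ← rpow_prefactor ham hK]
  ring

variable {d N : ℕ} {A : Matrix (Fin N) (Fin N) ℂ} (Y : Matrix (Fin N) (Fin N) ℂ)

theorem aOne_eq (A : Matrix (Fin N) (Fin N) ℂ) : aOne A = aMax A ^ 2 / aZero A / aMin A := by
  rw [aOne, div_div, mul_comm]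

theorem div_rpow_half {ϑ : ℝ} (hϑ0 : 0 < ϑ) (hϑ1 : ϑ < 1) :
    (ϑ / (1 - ϑ)) ^ ((1 : ℝ) / 2) = ϑ ^ ((1 : ℝ) / 2) * (1 / (1 - ϑ)) ^ ((1 : ℝ) / 2) := by
  have := sub_pos.2 hϑ1
  rw [← Real.mul_rpow hϑ0.le (by positivity), mul_one_div]

theorem constC7_eq (hd : 0 < d) (hmin : 0 < aMin A) (hmax : 0 < aMax A) (hzero : 0 < aZero A)
    {ϑ : ℝ} (hϑ0 : 0 < ϑ) (hϑ1 : ϑ < 1) (w Cθ : ℝ) :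
    cond Y * (4 * Real.pi * aMin A) ^ (-(d : ℝ) / 2) * Cθ * ((1 / w) ^ (1 : ℝ) *
      Real.pi ^ ((d : ℝ) / 2) * (4 * (aMax A ^ 2 / aZero A)) ^ (((d : ℝ) + (0 : ℕ)) / 2) /
      Real.Gamma ((d : ℝ) / 2) * expMoment (((d : ℝ) + (0 : ℕ)) / 2) 1 ϑ) =
      constC7 d A Y ϑ Cθ / w := by
  have := sub_pos.2 hϑ1
  have := Real.Gamma_pos_of_pos (by positivity : 0 < (d : ℝ) / 2)
  have hpre := rpow_prefactor hmin (by positivity : 0 < aMax A ^ 2 / aZero A) ((d : ℝ) / 2)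
  rw [← neg_div, ← aOne_eq] at hpre
  have hGamma : Real.Gamma (1 + 1 / 2) = Real.pi ^ ((1 : ℝ) / 2) / 2 := by
    rw [add_comm, Real.Gamma_add_one (by norm_num), Real.Gamma_one_half_eq, Real.sqrt_eq_rpow]
    ring
  have hpow : (1 / (1 - ϑ)) ^ ((1 : ℝ) + 1 / 2) = 1 / (1 - ϑ) * (1 / (1 - ϑ)) ^ ((1 : ℝ) / 2) := by
    rw [Real.rpow_add (by positivity), Real.rpow_one]
  rw [Nat.cast_zero, add_zero, constC7, expMoment, hGamma, hpow, div_rpow_half hϑ0 hϑ1,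
    Real.Gamma_one, Real.rpow_one, Real.rpow_one,
    show (1 : ℝ) / 2 - d / 2 = -((d : ℝ) - 1) / 2 by ring,
    show (1 : ℝ) - d / 2 = -((d : ℝ) - 2) / 2 by ring,
    show (1 : ℝ) + 1 / 2 = 3 / 2 by norm_num, show (d : ℝ) / 2 + 1 / 2 = ((d : ℝ) + 1) / 2 by ring,
    ← hpre]
  field_simp

theorem constC8_eq (hd : 0 < d) (hmin : 0 < aMin A) (hmax : 0 < aMax A) (hzero : 0 < aZero A)
    {ϑ w : ℝ} (hϑ0 : 0 < ϑ) (hϑ1 : ϑ < 1) (hw : 0 < w) (Cθ : ℝ) :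
    cond Y * ((2 * aMin A)⁻¹ * (4 * Real.pi * aMin A) ^ (-(d : ℝ) / 2)) * Cθ *
      ((1 / w) ^ ((1 : ℝ) / 2) * Real.pi ^ ((d : ℝ) / 2) *
      (4 * (aMax A ^ 2 / aZero A)) ^ (((d : ℝ) + (1 : ℕ)) / 2) / Real.Gamma ((d : ℝ) / 2) *
      expMoment (((d : ℝ) + (1 : ℕ)) / 2) (1 / 2) ϑ) =
      constC8 d A Y ϑ Cθ / w ^ ((1 : ℝ) / 2) := by
  have := sub_pos.2 hϑ1
  have := Real.Gamma_pos_of_pos (by positivity : 0 < (d : ℝ) / 2)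
  have := Real.Gamma_pos_of_pos (by norm_num : 0 < (1 : ℝ) / 2)
  have hpre := rpow_prefactor_half hmin (by positivity : 0 < aMax A ^ 2 / aZero A) ((d : ℝ) / 2)
  rw [← neg_div, ← aOne_eq, ← add_div] at hpre
  have hpow : (1 / (1 - ϑ)) ^ ((1 : ℝ) / 2 + 1 / 2) =
      (1 / (1 - ϑ)) ^ ((1 : ℝ) / 2) * (1 / (1 - ϑ)) ^ ((1 : ℝ) / 2) :=
    Real.rpow_add (by positivity) _ _
  have hcomm : aOne A ^ (((d : ℝ) + 1) / 2) * (Real.Gamma (1 / 2) / aMin A ^ ((1 : ℝ) / 2)) =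
      aOne A ^ (((d : ℝ) + 1) / 2) / aMin A ^ ((1 : ℝ) / 2) * Real.Gamma (1 / 2) := by
    ring
  rw [constC8, mul_assoc (Cθ * cond Y), hcomm, ← hpre, Nat.cast_one, expMoment, hpow,
    div_rpow_half hϑ0 hϑ1, one_div w, Real.inv_rpow hw.le,
    show (1 : ℝ) / 2 - ((d : ℝ) + 1) / 2 = -(d : ℝ) / 2 by ring,
    show (1 : ℝ) - ((d : ℝ) + 1) / 2 = -((d : ℝ) - 1) / 2 by ring,
    show (1 : ℝ) / 2 + 1 / 2 = 1 by norm_num,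
    show ((d : ℝ) + 1) / 2 + 1 / 2 = ((d : ℝ) + 2) / 2 by ring, Real.Gamma_one]
  field_simp

end Constants

/-! ### The resolvent -/

section WeightedSpace

variable {d N : ℕ} {θ : Rd d → ℝ} {v : Rd d → CN N} {C G : ℝ}

theorem MemCbW.mul_norm_le (hθ : ∀ x, 0 < θ x) (hv : MemCbW θ v) (x : Rd d) :
    θ x * ‖v x‖ ≤ normCbW θ v := by
  have := le_ciSup hv.2 x
  rwa [norm_smul, Real.norm_of_nonneg (hθ x).le] at this

theorem norm_weight_smul_le (hθ : ∀ x, 0 < θ x) (h : ∀ x, ‖v x‖ ≤ C * (1 / θ x) * G) (x : Rd d) :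
    ‖θ x • v x‖ ≤ C * G := by
  have hx := hθ x
  rw [norm_smul, Real.norm_of_nonneg hx.le]
  refine (mul_le_mul_of_nonneg_left (h x) hx.le).trans_eq ?_
  field_simp

theorem memCbW_of_norm_le (hθ : ∀ x, 0 < θ x) (hv : Continuous v)
    (h : ∀ x, ‖v x‖ ≤ C * (1 / θ x) * G) : MemCbW θ v :=
  ⟨hv, C * G, Set.forall_mem_range.2 (norm_weight_smul_le hθ h)⟩

theorem normCbW_le_of_norm_le (hθ : ∀ x, 0 < θ x) (h : ∀ x, ‖v x‖ ≤ C * (1 / θ x) * G) :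
    normCbW θ v ≤ C * G :=
  ciSup_le (norm_weight_smul_le hθ h)

end WeightedSpace

section Regularity

variable {d N : ℕ} {S : Matrix (Fin d) (Fin d) ℝ} {Y : Matrix (Fin N) (Fin N) ℂ} {a b : Fin N → ℂ}
  (ha : ∀ j, 0 < (a j).re) {ω : ℝ} {lam : ℂ} (hS : S.transpose = -S) (hY : IsUnit Y)
  (hb : ∀ j, -(b j).re ≤ ω) (hlam : ω < lam.re) (g : Crub S (CN N))
include hS hY hb hlam

theorem partialD_laplace_ouOp (i : Fin d) : partialD i (laplace (ouOp S Y ha b) lam g).1 =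
    (laplace (gradOp S Y ha b (EuclideanSpace.single i 1)) lam g).1 := by
  ext1 x
  rw [partialD, (hasFDerivAt_laplace_ouOp ha hS hY hb hlam g x).fderiv, ← partials_apply,
    ContinuousLinearEquiv.apply_symm_apply]

theorem memC1ub_laplace_ouOp : MemC1ub (laplace (ouOp S Y ha b) lam g).1 := by
  refine ⟨contDiff_one_of_hasFDerivAt_partials_symm (fun i => ContinuousMapClass.map_continuous _)
    (hasFDerivAt_laplace_ouOp ha hS hY hb hlam g), (memCrub_coe _).1, fun i => ?_⟩
  rw [partialD_laplace_ouOp ha hS hY hb hlam]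
  exact (memCrub_coe _).1

end Regularity

namespace SpectralData

variable {d N : ℕ} {S : Matrix (Fin d) (Fin d) ℝ} {A B Y : Matrix (Fin N) (Fin N) ℂ}
  {a b : Fin N → ℂ} (h : SpectralData A B Y a b)
include h

theorem sq_norm_le [NeZero N] (j : Fin N) : ‖a j‖ ^ 2 ≤ aMax A ^ 2 / aZero A * (a j).re := by
  have hzero := h.aZero_pos
  rw [div_mul_eq_mul_div, le_div_iff₀ hzero]
  gcongr
  exacts [h.le_aMax j, h.aZero_le j]

theorem sq_mul_le [NeZero N] {ϑ η w : ℝ} (hη : η ^ 2 ≤ ϑ * (aZero A * w / aMax A ^ 2)) :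
    η ^ 2 * (aMax A ^ 2 / aZero A) ≤ ϑ * w := by
  have hzero := h.aZero_pos
  have hmax := h.aMax_pos
  refine (mul_le_mul_of_nonneg_right hη (by positivity)).trans_eq ?_
  field_simp

theorem isGeneratorValue_iff_tendstoUniformly (v w : Crub S (CN N)) :
    IsGeneratorValue (ouOp S Y h.re_pos b) v w ↔
      TendstoUniformly (fun (t : ℝ) (x : Rd d) => t⁻¹ • (semigroup A B S t v.1 x - v.1 x)) w.1
        (𝓝[>] 0) := by
  rw [IsGeneratorValue, tendsto_subtype_rng,
    BoundedContinuousFunction.tendsto_iff_tendstoUniformly]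
  refine tendstoUniformly_congr ?_
  filter_upwards [self_mem_nhdsWithin] with t ht
  ext1 x
  rw [h.semigroup_eq ht]
  rfl

variable {lam : ℂ} (hlam : omegaB B < lam.re) (hS : S.transpose = -S) (g : Crub S (CN N))
include hlam hS

theorem solvesResolvent_iff {u : Rd d → CN N} : SolvesResolvent A B S lam g.1 u ↔
    u = (laplace (ouOp S Y h.re_pos b) lam g).1 := by
  obtain ⟨M, hT⟩ := exists_isC0Semigroup_ouOp hS h.isUnit h.re_pos h.neg_re_le_omegaB
  constructor
  · rintro ⟨w, ⟨hu, -, hlim⟩, heq⟩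
    obtain ⟨U, hU⟩ := hu.exists_crub
    obtain rfl : U.1 = u := funext hU
    obtain rfl : (lam • U - g).1 = w := funext fun x => by
      change lam • U.1 x - g.1 x = w x
      rw [← heq x, sub_sub_cancel]
    rw [← ((h.isGeneratorValue_iff_tendstoUniformly _ _).2 hlim).eq_laplace hT hlam]
  · rintro rfl
    exact ⟨_, ⟨memCrub_coe _, memCrub_coe _, (h.isGeneratorValue_iff_tendstoUniformly _ _).1
      (isGeneratorValue_laplace hT hlam g)⟩, fun x => sub_sub_cancel _ _⟩

variable [NeZero N] {ϑ η Cθ : ℝ} (hϑ0 : 0 < ϑ) (hϑ1 : ϑ < 1) {θ : Rd d → ℝ}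
  (hθ : IsRadialWeight θ η Cθ)
  (hη : η ^ 2 * (aMax A ^ 2 / aZero A) ≤ ϑ * (lam.re - omegaB B)) (hd : 0 < d)
include hϑ0 hϑ1 hθ hη hd

theorem norm_laplace_ouOp_le (hg : MemCbW θ g.1) (x : Rd d) :
    ‖(laplace (ouOp S Y h.re_pos b) lam g).1 x‖ ≤
      constC7 d A Y ϑ Cθ / (lam.re - omegaB B) * (1 / θ x) * normCbW θ g.1 := by
  have hmin := h.aMin_pos
  have hmax := h.aMax_pos
  have hzero := h.aZero_pos
  have hK : 0 < aMax A ^ 2 / aZero A := by positivity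
  have := Fin.pos_iff_nonempty.1 hd
  obtain ⟨M, hT⟩ := exists_isC0Semigroup_ouOp hS h.isUnit h.re_pos h.neg_re_le_omegaB
  refine (norm_laplace_matrixOp_apply_le hθ (hg.mul_norm_le hθ.pos) hS h.isUnit
    (integrable_heatFun h.re_pos b) (integrableOn_laplaceOrbit hT hlam g) (by positivity)
    (fun t ht => norm_heatFun_le hmin hK h.aMin_le h.sq_norm_le h.neg_re_le_omegaB ht) hlam hK hη
    hϑ0 hϑ1 one_pos x).trans_eq ?_
  rw [← constC7_eq Y hd hmin hmax hzero hϑ0 hϑ1]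
  ring

theorem norm_laplace_gradOp_le (hg : MemCbW θ g.1) {e : Rd d} (he : ‖e‖ = 1) (x : Rd d) :
    ‖(laplace (gradOp S Y h.re_pos b e) lam g).1 x‖ ≤ constC8 d A Y ϑ Cθ /
      (lam.re - omegaB B) ^ ((1 : ℝ) / 2) * (1 / θ x) * normCbW θ g.1 := by
  have hmin := h.aMin_pos
  have hmax := h.aMax_pos
  have hzero := h.aZero_pos
  have hK : 0 < aMax A ^ 2 / aZero A := by positivity
  have := Fin.pos_iff_nonempty.1 hd
  refine (norm_laplace_matrixOp_apply_le hθ (hg.mul_norm_le hθ.pos) hS h.isUnit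
    (integrable_gradFun h.re_pos b e)
    (integrableOn_laplaceOrbit_gradOp h.re_pos hS Y h.neg_re_le_omegaB hlam g e) (by positivity)
    (fun t ht => norm_gradFun_le hmin hK h.aMin_le h.sq_norm_le h.neg_re_le_omegaB hS he ht) hlam hK
    hη hϑ0 hϑ1 one_half_pos x).trans_eq ?_
  rw [← constC8_eq Y hd hmin hmax hzero hϑ0 hϑ1 (sub_pos.2 hlam)]
  ring

end SpectralData

end OU

end

theorem theorem6p5_general {d N : ℕ} (hd : 0 < d) (hN : 1 ≤ N)
    (A B Y : Matrix (Fin N) (Fin N) ℂ) (S : Matrix (Fin d) (Fin d) ℝ)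
    (hABY : OU.SimDiagonalizable A B Y)
    (hA : ∀ z ∈ spectrum ℂ A, 0 < z.re)
    (hS : S.transpose = -S)
    (ϑ : ℝ) (hϑ0 : 0 < ϑ) (hϑ1 : ϑ < 1)
    (lam : ℂ) (hlam : OU.omegaB B < lam.re)
    (θ : OU.Rd d → ℝ) (η Cθ : ℝ) (hθ : OU.IsRadialWeight θ η Cθ)
    (hη : η ^ 2 ≤ ϑ * (OU.aZero A * (lam.re - OU.omegaB B) / OU.aMax A ^ 2))
    (g : OU.Rd d → OU.CN N) (hg : OU.MemCrub S g) :
    ∃ v : OU.Rd d → OU.CN N,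
      OU.SolvesResolvent A B S lam g v ∧
      (∀ u, OU.SolvesResolvent A B S lam g u → u = v) ∧
      OU.MemCrub S v ∧ OU.MemC1ub v ∧
      (OU.MemCbW θ g →
        OU.MemC1bW θ v ∧
        OU.normCbW θ v ≤
          OU.constC7 d A Y ϑ Cθ / (lam.re - OU.omegaB B) * OU.normCbW θ g ∧
        (∀ i : Fin d, OU.normCbW θ (OU.partialD i v) ≤
          OU.constC8 d A Y ϑ Cθ / (lam.re - OU.omegaB B) ^ ((1 : ℝ) / 2) * OU.normCbW θ g) ∧
        (∀ x, ‖v x‖ ≤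
          OU.constC7 d A Y ϑ Cθ / (lam.re - OU.omegaB B) * (1 / θ x) * OU.normCbW θ g) ∧
        (∀ (i : Fin d) (x), ‖OU.partialD i v x‖ ≤
          OU.constC8 d A Y ϑ Cθ / (lam.re - OU.omegaB B) ^ ((1 : ℝ) / 2) * (1 / θ x) *
            OU.normCbW θ g)) := by
  have : NeZero N := ⟨by omega⟩
  obtain ⟨a, b, h⟩ := OU.exists_spectralData hABY hA
  obtain ⟨f, hf⟩ := hg.exists_crub
  obtain rfl : f.1 = g := funext hf
  have hη' := h.sq_mul_le hη
  have hsolves {u} := h.solvesResolvent_iff hlam hS f (u := u)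
  have hC1 := OU.memC1ub_laplace_ouOp h.re_pos hS h.isUnit h.neg_re_le_omegaB hlam f
  set v := (OU.laplace (OU.ouOp S Y h.re_pos b) lam f).1
  refine ⟨v, hsolves.2 rfl, fun u => hsolves.1, OU.memCrub_coe _, hC1, fun hgθ => ?_⟩
  have hv := h.norm_laplace_ouOp_le hlam hS f hϑ0 hϑ1 hθ hη' hd hgθ
  have hDv (i : Fin d) (x : OU.Rd d) : ‖OU.partialD i v x‖ ≤ OU.constC8 d A Y ϑ Cθ /
      (lam.re - OU.omegaB B) ^ ((1 : ℝ) / 2) * (1 / θ x) * OU.normCbW θ f.1 := by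
    rw [OU.partialD_laplace_ouOp h.re_pos hS h.isUnit h.neg_re_le_omegaB hlam]
    exact h.norm_laplace_gradOp_le hlam hS f hϑ0 hϑ1 hθ hη' hd hgθ (by simp) x
  exact ⟨⟨hC1.1, OU.memCbW_of_norm_le hθ.pos hC1.1.continuous hv, fun i =>
      OU.memCbW_of_norm_le hθ.pos (hC1.2.2 i).1.1 (hDv i)⟩,
    OU.normCbW_le_of_norm_le hθ.pos hv, fun i => OU.normCbW_le_of_norm_le hθ.pos (hDv i), hv, hDv⟩

theorem theorem6p5 {d N : ℕ} (hd : 2 ≤ d) (hN : 1 ≤ N)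
    (A B Y : Matrix (Fin N) (Fin N) ℂ) (S : Matrix (Fin d) (Fin d) ℝ)
    (hABY : OU.SimDiagonalizable A B Y)
    (hA : ∀ z ∈ spectrum ℂ A, 0 < z.re)
    (hS : S.transpose = -S)
    (ϑ : ℝ) (hϑ0 : 0 < ϑ) (hϑ1 : ϑ < 1)
    (lam : ℂ) (hlam : OU.omegaB B < lam.re)
    (θ : OU.Rd d → ℝ) (η Cθ : ℝ) (hθ : OU.IsRadialWeight θ η Cθ)
    (hη : η ^ 2 ≤ ϑ * (OU.aZero A * (lam.re - OU.omegaB B) / OU.aMax A ^ 2))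
    (hθlow : ∃ C : ℝ, 0 < C ∧ ∀ x, C ≤ θ x)
    (g : OU.Rd d → OU.CN N) (hg : OU.MemCrub S g) :
    ∃ v : OU.Rd d → OU.CN N,
      OU.SolvesResolvent A B S lam g v ∧
      (∀ u, OU.SolvesResolvent A B S lam g u → u = v) ∧
      OU.MemCrub S v ∧ OU.MemC1ub v ∧
      (OU.MemCbW θ g →
        OU.MemC1bW θ v ∧
        OU.normCbW θ v ≤
          OU.constC7 d A Y ϑ Cθ / (lam.re - OU.omegaB B) * OU.normCbW θ g ∧
        (∀ i : Fin d, OU.normCbW θ (OU.partialD i v) ≤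
          OU.constC8 d A Y ϑ Cθ / (lam.re - OU.omegaB B) ^ ((1 : ℝ) / 2) * OU.normCbW θ g) ∧
        (∀ x, ‖v x‖ ≤
          OU.constC7 d A Y ϑ Cθ / (lam.re - OU.omegaB B) * (1 / θ x) * OU.normCbW θ g) ∧
        (∀ (i : Fin d) (x), ‖OU.partialD i v x‖ ≤
          OU.constC8 d A Y ϑ Cθ / (lam.re - OU.omegaB B) ^ ((1 : ℝ) / 2) * (1 / θ x) *
            OU.normCbW θ g)) :=
  theorem6p5_general (by omega) hN A B Y S hABY hA hS ϑ hϑ0 hϑ1 lam hlam θ η Cθ hθ hη g hg
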